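/- Setting. The design domain $\Omega\subset\mathbb{R}^2$ is the union of $n$ non-overlapping measurable finite elements $\Omega_e$ of finite areas $v_e>0$, with centers $c_e$. For a filter radius $R>0$ and a nonnegative kernel $F$ let $V(e)=\{j: |c_j-c_e|<R\}$ and $F_{ej}=\int_{\Omega_j}F(x-c_e)\,dx$ (assumed to exist, with $\sum_{j\in V(e)}F_{ej}>0$). The filtered density of $\rho\in\mathbb{R}^n$ is $\tilde\rho_e=\sum_{j\in V(e)}\rho_jF_{ej}\big/\sum_{j\in V(e)}F_{ej}$. Let $p>1$, $E_0>E_D>0$, $-1<\nu<1/2$, $E(t)=\big(\tfrac{1-t}{E_0}+\tfrac{t}{E_D}\big)^{-1}$, and let $$C=\frac1{(1+\nu)(1-2\nu)}\begin{pmatrix}1-\nu&\nu&0\\ \nu&1-\nu&0\\0&0&(1-2\nu)/2\end{pmatrix}.$$ Given strain displacement matrices $B_{el}\in\mathbb{R}^{3\times m}$ ($l=1,\dots,q$), the stiffness matrices are $K_e(\rho,\delta)=\sum_{l}B_{el}^\top\,\tilde\rho_e^{\,p}E(\delta_e)\,C\,B_{el}$ and $K=\sum_{e=1}^nK_e$.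 Let $0<\rho_{\min}$, $V,D\in\mathbb{R}$, let $f\in\mathbb{R}^m$ be a load vector, and put $$U_{\mathrm{ad}}=\Big\{\rho\in\mathbb{R}^n:\ \rho_{\min}\le\rho_e\le1\ (e=1,\dots,n),\ \sum_{e}v_e\rho_e/|\Omega|\le V\Big\},$$ $$\Delta_{\mathrm{ad}}(\rho)=\Big\{\delta\in\mathbb{R}^n:\ 0\le\delta_e\le1\ (e=1,\dots,n),\ \sum_{e}v_e\tilde\rho_e^{\,p}\delta_e/|\Omega|=D\Big\}.$$ Assume that $K(\rho,\delta)$ is positive definite for all $\rho\in U_{\mathrm{ad}}$ and $\delta\in[0,1]^n$. For $\epsilon>0$ let $$\mathcal{J}_\epsilon(\rho,\delta,u)=2f^\top u-\sum_{e=1}^nu^\top K_e(\rho,\delta)u-\frac\epsilon2\|\delta\|^2,\qquad F_\epsilon(\rho)=\max_{\delta\in\Delta_{\mathrm{ad}}(\rho),\,u\in\mathbb{R}^m}\mathcal{J}_\epsilon(\rho,\delta,u).$$ Theorem. Let $\epsilon>0$ and let $\bar\rho\in U_{\mathrm{ad}}$ with $\Delta_{\mathrm{ad}}(\bar\rho)\neq\emptyset$.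 Then the inner maximization problem at $\bar\rho$ has a unique maximizer $(\bar\delta,\bar u)$. Assume that the linear independence constraint qualification (LICQ) holds there: the gradients with respect to $(\delta,u)$ of the equality constraint $\sum_ev_e\tilde{\bar\rho}_e^{\,p}\delta_e/|\Omega|-D=0$ and of those constraints $-\delta_e\le0$, $\delta_e-1\le0$ that are active at $\bar\delta$ are linearly independent. Then the inner problem at $\bar\rho$ has a unique vector of Karush-Kuhn-Tucker multipliers at $(\bar\delta,\bar u)$. Let $\bar\lambda\in\mathbb{R}$ be its component for the equality constraint, with the sign convention $\nabla_{(\delta,u)}\mathcal{J}_\epsilon-\sum_i\bar\lambda_i\nabla_{(\delta,u)}g_i-\bar\lambda\,\nabla_{(\delta,u)}h=0$, $\bar\lambda_i\ge0$, $\bar\lambda_ig_i=0$, where $g_i\le0$ are the $2n$ bound constraints and $h=0$ is the equality constraint. Moreover the maximum defining $F_\epsilon$ is attained for all $\rho\in\mathbb{R}^n$ in a neighbourhood of $\bar\rho$, $F_\epsilon$ is continuously differentiable at $\bar\rho$ (that is, $C^1$ in a neighbourhood of $\bar\rho$), and $$\nabla F_\epsilon(\bar\rho)=-\Big[\bar u^\top\frac{\partial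 K(\bar\rho,\bar\delta)}{\partial\rho_e}\bar u\Big]_{e=1}^n-\bar\lambda\,\nabla_\rho\Big(\sum_{e=1}^nv_e\tilde\rho_e^{\,p}\bar\delta_e/|\Omega|\Big)\Big|_{\rho=\bar\rho}.$$ -/

import Mathlib

open scoped Matrix Topology

noncomputable section

/-! ### Parametric nonlinear programs: maximizers, constraint qualification, multipliers -/

namespace ParamProgram

variable {X Y : Type*} [NormedAddCommGroup Y] [NormedSpace ℝ Y] {ι κ : Type*}

/-- The feasible set `Y(x) = {y | G(x,y) ≤ 0, H(x,y) = 0}`. -/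
def feasible (G : X → Y → ι → ℝ) (H : X → Y → κ → ℝ) (x : X) : Set Y :=
  {y | (∀ i, G x y i ≤ 0) ∧ ∀ k, H x y k = 0}

/-- The set `M(x)` of maximizers of `j(x, ·)` over `Y(x)`. -/
def maximizers (j : X → Y → ℝ) (G : X → Y → ι → ℝ) (H : X → Y → κ → ℝ) (x : X) : Set Y :=
  {y | y ∈ feasible G H x ∧ ∀ z ∈ feasible G H x, j x z ≤ j x y}

/-- Linear independence constraint qualification at a point `y`: the `y`-differentials of all
equality constraints and of the active inequality constraints are linearly independent. (The
differentials are the gradients, regarded as linear functionals.) -/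
def LICQ (G : X → Y → ι → ℝ) (H : X → Y → κ → ℝ) (x : X) (y : Y) : Prop :=
  LinearIndependent ℝ
    (Sum.elim (fun k : κ => fderiv ℝ (fun z => H x z k) y)
      (fun i : {i : ι // G x y i = 0} => fderiv ℝ (fun z => G x z i.1) y))

/-- The set of optimal Lagrange multipliers `(lam, mu)` at `(x, y)`, `lam` belonging to the
inequality constraints and `mu` to the equality constraints of a maximization problem. -/
def multipliers [Fintype ι] [Fintype κ] (j : X → Y → ℝ) (G : X → Y → ι → ℝ)
    (H : X → Y → κ → ℝ) (x : X) (y : Y) : Set ((ι → ℝ) × (κ → ℝ)) :=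
  {p | fderiv ℝ (j x) y - ∑ i, p.1 i • fderiv ℝ (fun z => G x z i) y
        - ∑ k, p.2 k • fderiv ℝ (fun z => H x z k) y = 0 ∧
      (∀ i, p.1 i * G x y i = 0) ∧ ∀ i, 0 ≤ p.1 i}

end ParamProgram

/-! ### The discretized structure -/

/-- The plane strain unit stiffness tensor (Young's modulus one) with Poisson's ratio `nu`, acting
on the strains `(ε_xx, ε_yy, γ_xy)`. -/
def unitTensor (nu : ℝ) : Matrix (Fin 3) (Fin 3) ℝ :=
  (1 / ((1 + nu) * (1 - 2 * nu))) •
    !![1 - nu, nu, 0; nu, 1 - nu, 0; 0, 0, (1 - 2 * nu) / 2]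

/-- The data of the discretized problem with `n` finite elements, `m` displacement degrees of
freedom and `q` integration points per element. -/
structure TopOptModel (n m q : ℕ) where
  /-- the finite elements -/
  elem : Fin n → Set (EuclideanSpace ℝ (Fin 2))
  elem_measurable : ∀ e, MeasurableSet (elem e)
  elem_nonoverlapping : Pairwise fun i j => MeasureTheory.AEDisjoint MeasureTheory.volume
    (elem i) (elem j)
  elem_pos : ∀ e, 0 < MeasureTheory.volume (elem e)
  elem_finite : ∀ e, MeasureTheory.volume (elem e) < ⊤
  /-- the element centers -/
  center : Fin n → EuclideanSpace ℝ (Fin 2)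
  /-- the filter radius -/
  R : ℝ
  R_pos : 0 < R
  /-- the filter kernel -/
  kernel : EuclideanSpace ℝ (Fin 2) → ℝ
  kernel_nonneg : ∀ x, 0 ≤ kernel x
  kernel_integrable : ∀ e j, MeasureTheory.IntegrableOn (fun x => kernel (x - center e)) (elem j)
  /-- the denominators of the discrete filter do not vanish -/
  kernel_mass_pos : ∀ e, 0 < ∑ j with dist (center j) (center e) < R,
    ∫ x in elem j, kernel (x - center e)
  /-- the penalty exponent -/
  p : ℝ
  one_lt_p : 1 < p
  /-- largest and smallest Young's modulus -/
  E0 : ℝ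
  ED : ℝ
  ED_pos : 0 < ED
  ED_lt_E0 : ED < E0
  /-- Poisson's ratio -/
  nu : ℝ
  neg_one_lt_nu : -1 < nu
  nu_lt_half : nu < 1 / 2
  /-- the strain displacement matrices -/
  B : Fin n → Fin q → Matrix (Fin 3) (Fin m) ℝ
  /-- the external load vector -/
  f : EuclideanSpace ℝ (Fin m)
  /-- the lower density bound -/
  rhoMin : ℝ
  rhoMin_pos : 0 < rhoMin
  /-- the bound on the admissible volume -/
  V : ℝ
  /-- the total material uncertainty -/
  D : ℝ

namespace TopOptModel

variable {n m q : ℕ} (P : TopOptModel n m q)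

/-- The volume `v_e` of the element `e`. -/
def vol (e : Fin n) : ℝ := (MeasureTheory.volume (P.elem e)).toReal

/-- The volume `|Ω|` of the design domain, the union of the elements. -/
def totalVol : ℝ := (MeasureTheory.volume (⋃ e, P.elem e)).toReal

/-- The filter weights `F_{ej}`. -/
def weight (e j : Fin n) : ℝ := ∫ x in P.elem j, P.kernel (x - P.center e)

/-- The set `V(e)` of neighbour elements of `e`. -/
def nbhd (e : Fin n) : Finset (Fin n) := {j | dist (P.center j) (P.center e) < P.R}

/-- The filtered density `ρ̃_e = (F * ρ)_e`. -/
def filtered (rho : EuclideanSpace ℝ (Fin n)) (e : Fin n) : ℝ :=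
  (∑ j ∈ P.nbhd e, rho j * P.weight e j) / ∑ j ∈ P.nbhd e, P.weight e j

/-- The inverse interpolation `E(t) = ((1-t)/E₀ + t/E_D)⁻¹`. -/
def young (t : ℝ) : ℝ := ((1 - t) / P.E0 + t / P.ED)⁻¹

/-- The material property function `C_e(ρ,δ) = ρ̃_e^p E(δ_e) C`. -/
def material (rho delta : EuclideanSpace ℝ (Fin n)) (e : Fin n) : Matrix (Fin 3) (Fin 3) ℝ :=
  P.filtered rho e ^ P.p • P.young (delta e) • unitTensor P.nu

/-- The local stiffness matrix `K_e(ρ,δ)`. -/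
def localStiffness (rho delta : EuclideanSpace ℝ (Fin n)) (e : Fin n) :
    Matrix (Fin m) (Fin m) ℝ :=
  ∑ l, (P.B e l)ᵀ * P.material rho delta e * P.B e l

/-- The global stiffness matrix `K(ρ,δ)`. -/
def stiffness (rho delta : EuclideanSpace ℝ (Fin n)) : Matrix (Fin m) (Fin m) ℝ :=
  ∑ e, P.localStiffness rho delta e

/-- The admissible set `U_ad` of pseudo-densities. -/
def Uad : Set (EuclideanSpace ℝ (Fin n)) :=
  {rho | (∀ e, P.rhoMin ≤ rho e ∧ rho e ≤ 1) ∧ ∑ e, P.vol e * rho e / P.totalVol ≤ P.V}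

/-- The weighted total uncertainty `∑_e v_e ρ̃_e^p δ_e / |Ω|`. -/
def budget (rho delta : EuclideanSpace ℝ (Fin n)) : ℝ :=
  ∑ e, P.vol e * P.filtered rho e ^ P.p * delta e / P.totalVol

/-- The density-dependent uncertainty set `Δ_ad(ρ)`. -/
def DeltaAd (rho : EuclideanSpace ℝ (Fin n)) : Set (EuclideanSpace ℝ (Fin n)) :=
  {delta | (∀ e, 0 ≤ delta e ∧ delta e ≤ 1) ∧ P.budget rho delta = P.D}

/-- The regularized objective
`J_ε(ρ,(δ,u)) = 2 fᵀu - ∑_e uᵀ K_e(ρ,δ) u - (ε/2) ‖δ‖²`. -/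
def J (eps : ℝ) (rho : EuclideanSpace ℝ (Fin n))
    (y : EuclideanSpace ℝ (Fin n) × EuclideanSpace ℝ (Fin m)) : ℝ :=
  2 * (P.f.ofLp ⬝ᵥ y.2.ofLp)
    - ∑ e, y.2.ofLp ⬝ᵥ (P.localStiffness rho y.1 e *ᵥ y.2.ofLp)
    - eps / 2 * ‖y.1‖ ^ 2

/-- The inequality constraints `-δ_e ≤ 0` and `δ_e - 1 ≤ 0` of the inner problem. -/
def G (_rho : EuclideanSpace ℝ (Fin n))
    (y : EuclideanSpace ℝ (Fin n) × EuclideanSpace ℝ (Fin m)) : Fin n ⊕ Fin n → ℝ :=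
  Sum.elim (fun e => -y.1 e) (fun e => y.1 e - 1)

/-- The equality constraint `∑_e v_e ρ̃_e^p δ_e / |Ω| - D = 0` of the inner problem. -/
def H (rho : EuclideanSpace ℝ (Fin n))
    (y : EuclideanSpace ℝ (Fin n) × EuclideanSpace ℝ (Fin m)) : Unit → ℝ :=
  fun _ => P.budget rho y.1 - P.D

/-- The constraint functions describe exactly `Δ_ad(ρ) × ℝ^m`. -/
theorem feasible_eq (rho : EuclideanSpace ℝ (Fin n)) :
    ParamProgram.feasible (G (n := n) (m := m)) P.H rho = P.DeltaAd rho ×ˢ Set.univ := by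
  ext y
  simp only [ParamProgram.feasible, G, H, DeltaAd, Set.mem_ofPred_eq, Set.mem_prod, Set.mem_univ,
    and_true, Sum.forall, Sum.elim_inl, Sum.elim_inr, forall_const, sub_nonpos, sub_eq_zero,
    Left.neg_nonpos_iff, forall_and]

/-- The marginal function `F_ε(ρ) = max_{δ ∈ Δ_ad(ρ), u ∈ ℝ^m} J_ε(ρ,δ,u)`. -/
def Feps (eps : ℝ) (rho : EuclideanSpace ℝ (Fin n)) : ℝ :=
  sSup {t | ∃ delta ∈ P.DeltaAd rho, ∃ u, P.J eps rho (delta, u) = t}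

/-- The partial derivative `∂K(ρ,δ)/∂ρ_e` of the stiffness matrix, entry by entry. -/
def dStiffness (rho delta : EuclideanSpace ℝ (Fin n)) (e : Fin n) : Matrix (Fin m) (Fin m) ℝ :=
  Matrix.of fun i k =>
    fderiv ℝ (fun r => P.stiffness r delta i k) rho (EuclideanSpace.single e 1)

end TopOptModel

end

/-! The inner problem is concave: `E(δ_e)` is the reciprocal of a positive affine function, so each
term of the strain energy is a quadratic form divided by a linear one, hence jointly convex in `(δ,
u)` (`young_energy_midpoint`). The `ε`-term makes the maximizer unique in `δ`, and coercivity of the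
strain energy makes it unique in `u`.

The difficulty is that the feasible set moves with `ρ`. LICQ is used once, to produce a coordinate
`e` with `0 < δ_e < 1` (`exists_free_of_LICQ`). Shifting that coordinate alone restores the budget
at nearby densities (`restore`), so a feasible point at one density becomes feasible at its
neighbours. Compactness and uniqueness then make the maximizer `z` continuous near `ρ̄`
(`continuousAt_maximizer`). With the budget eliminated, `F_ε(ρ) = reducedJ(ρ, z(ρ))`, while
`reducedJ(ρ, z(ρ'))` is at most `F_ε(ρ)` for close `ρ, ρ'`; this is the situation of the envelope
theorem `ContDiffAt.envelope`, which gives `C¹` and says that `z` may be frozen when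
differentiating.

In the chain rule for `reducedJ` the restoring shift contributes `-(∂J/∂δ_e / coef_e) ∇budget`. The
bounds on `δ_e` are inactive, so the quotient `∂J/∂δ_e / coef_e` is the budget multiplier
(`multipliers_eq`), which yields the gradient formula. -/

noncomputable section

/-! ### The envelope theorem for a unique continuous maximizer -/

section Envelope

variable {X Z : Type*} [NormedAddCommGroup X] [NormedSpace ℝ X]
  [NormedAddCommGroup Z] [NormedSpace ℝ Z]

/-- The increment of `F` is squeezed between those of `Φ` in the first variable with second variable
frozen at `z x` (below) and at `z x'` (above). The upper increment has a moving base point, which is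
why strict differentiability is needed. -/
theorem HasStrictFDerivAt.hasFDerivAt_envelope {Φ : X × Z → ℝ} {Φ' : X × Z →L[ℝ] ℝ}
    {F : X → ℝ} {z : X → Z} {x : X} (hΦ : HasStrictFDerivAt Φ Φ' (x, z x))
    (hz : ContinuousAt z x) (hF : ∀ᶠ x' in 𝓝 x, F x' = Φ (x', z x'))
    (hle : ∀ᶠ x' in 𝓝 x, Φ (x', z x) ≤ F x') (hge : ∀ᶠ x' in 𝓝 x, Φ (x, z x') ≤ F x) :
    HasFDerivAt F (Φ'.comp (ContinuousLinearMap.inl ℝ X Z)) x := by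
  rw [hasFDerivAt_iff_isLittleO, Asymptotics.isLittleO_iff]
  intro c hc
  have h := (Asymptotics.isLittleO_iff.1 hΦ.isLittleO) hc
  have hid : Filter.Tendsto (fun x' : X => x') (𝓝 x) (𝓝 x) := Filter.tendsto_id
  have t1 : Filter.Tendsto (fun x' : X => ((x', z x), (x, z x))) (𝓝 x)
      (𝓝 ((x, z x), (x, z x))) :=
    (hid.prodMk_nhds tendsto_const_nhds).prodMk_nhds tendsto_const_nhds
  have t2 : Filter.Tendsto (fun x' : X => ((x', z x'), (x, z x'))) (𝓝 x)
      (𝓝 ((x, z x), (x, z x))) :=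
    (hid.prodMk_nhds hz).prodMk_nhds (tendsto_const_nhds.prodMk_nhds hz)
  have hFx : F x = Φ (x, z x) := hF.self_of_nhds
  filter_upwards [t1.eventually h, t2.eventually h, hF, hle, hge] with x' h1 h2 h3 h4 h5
  have e1 : ((x', z x) : X × Z) - (x, z x) = (x' - x, 0) := by simp
  have e2 : ((x', z x') : X × Z) - (x, z x') = (x' - x, 0) := by simp
  simp only [e1, e2, Prod.norm_mk, norm_zero, norm_nonneg, sup_of_le_left, Real.norm_eq_abs,
    abs_le] at h1 h2
  simp only [ContinuousLinearMap.comp_apply, ContinuousLinearMap.inl_apply, Real.norm_eq_abs,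
    abs_le]
  constructor <;> linarith [h1.1, h1.2, h2.1, h2.2]

/-- Taking `p.2 = x` or `p.1 = x` in `hge` gives the two one-sided inequalities of the previous
lemma at every point of `U`, so the derivative formula holds near `x₀`; its right-hand side is
continuous because `z` is. -/
theorem ContDiffAt.envelope {Φ : X × Z → ℝ} {F : X → ℝ} {z : X → Z} {x₀ : X}
    (hΦ : ContDiffAt ℝ 1 Φ (x₀, z x₀)) {U : Set X} (hU : IsOpen U) (hx₀ : x₀ ∈ U)
    (hz : ContinuousOn z U) (hF : ∀ x ∈ U, F x = Φ (x, z x))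
    (hge : ∀ x ∈ U, ∀ᶠ p in 𝓝 (x, x), Φ (p.1, z p.2) ≤ F p.1) :
    ContDiffAt ℝ 1 F x₀ ∧
      HasFDerivAt F ((fderiv ℝ Φ (x₀, z x₀)).comp (ContinuousLinearMap.inl ℝ X Z)) x₀ := by
  have hg : ContinuousOn (fun x => (x, z x)) U := continuousOn_id.prodMk hz
  have hat : ∀ x ∈ U, ContDiffAt ℝ 1 Φ (x, z x) → HasFDerivAt F
      ((fderiv ℝ Φ (x, z x)).comp (ContinuousLinearMap.inl ℝ X Z)) x := by
    intro x hx h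
    have hid : Filter.Tendsto (fun x' : X => x') (𝓝 x) (𝓝 x) := Filter.tendsto_id
    refine (h.hasStrictFDerivAt one_ne_zero).hasFDerivAt_envelope
      (hz.continuousAt (hU.mem_nhds hx)) ?_ ?_ ?_
    · filter_upwards [hU.mem_nhds hx] with x' hx' using hF x' hx'
    · exact (hid.prodMk_nhds (tendsto_const_nhds (x := x))).eventually (hge x hx)
    · exact ((tendsto_const_nhds (x := x)).prodMk_nhds hid).eventually (hge x hx)
  refine ⟨?_, hat x₀ hx₀ hΦ⟩
  have hev := (hg.continuousAt (hU.mem_nhds hx₀)).eventually (hΦ.eventually (by simp))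
  rw [contDiffAt_one_iff]
  refine ⟨fun x => (fderiv ℝ Φ (x, z x)).comp (ContinuousLinearMap.inl ℝ X Z),
    U ∩ {x | ContDiffAt ℝ 1 Φ (x, z x)}, Filter.inter_mem (hU.mem_nhds hx₀) hev, ?_, ?_⟩
  · intro x hx
    have h0 : ContDiffAt ℝ 1 Φ (x, z x) := hx.2
    have h1 : ContinuousAt (fderiv ℝ Φ) (x, z x) :=
      (h0.fderiv_right (m := 0) (by simp)).continuousAt
    have h2 : ContinuousAt (fun x => (x, z x)) x := hg.continuousAt (hU.mem_nhds hx.1)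
    have h3 : ContinuousAt (fun x => fderiv ℝ Φ (x, z x)) x :=
      ContinuousAt.comp (f := fun x => (x, z x)) (g := fderiv ℝ Φ) h1 h2
    exact (h3.clm_comp continuousAt_const).continuousWithinAt
  · intro x hx
    exact hat x hx.1 hx.2

end Envelope

namespace TopOptModel

variable {n m q : ℕ} (P : TopOptModel n m q)

/-! ### Separating densities, uncertainties and displacements -/

/-- The stiffness matrix of the element `e` for unit density and unit Young's modulus. -/
def unitStiffness (e : Fin n) : Matrix (Fin m) (Fin m) ℝ :=
  ∑ l, (P.B e l)ᵀ * unitTensor P.nu * P.B e l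

/-- The quadratic form of `unitStiffness`. -/
def energy (e : Fin n) (u : EuclideanSpace ℝ (Fin m)) : ℝ :=
  u.ofLp ⬝ᵥ (P.unitStiffness e *ᵥ u.ofLp)

/-- The strain energy `uᵀ K(ρ,δ) u`. -/
def strain (rho delta : EuclideanSpace ℝ (Fin n)) (u : EuclideanSpace ℝ (Fin m)) : ℝ :=
  ∑ e, P.filtered rho e ^ P.p * P.young (delta e) * P.energy e u

/-- The coefficient of `δ_e` in the uncertainty budget. -/
def coef (rho : EuclideanSpace ℝ (Fin n)) (e : Fin n) : ℝ :=
  P.vol e * P.filtered rho e ^ P.p / P.totalVol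

theorem budget_eq (rho delta : EuclideanSpace ℝ (Fin n)) :
    P.budget rho delta = ∑ e, P.coef rho e * delta e := by
  simp only [budget, coef]
  exact Finset.sum_congr rfl fun e _ => by ring

theorem localStiffness_eq (rho delta : EuclideanSpace ℝ (Fin n)) (e : Fin n) :
    P.localStiffness rho delta e =
      (P.filtered rho e ^ P.p * P.young (delta e)) • P.unitStiffness e := by
  simp [localStiffness, material, unitStiffness, Finset.smul_sum, smul_smul]

theorem stiffness_apply (rho delta : EuclideanSpace ℝ (Fin n)) (i k : Fin m) :
    P.stiffness rho delta i k =
      ∑ e, P.filtered rho e ^ P.p * P.young (delta e) * P.unitStiffness e i k := by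
  simp [stiffness, localStiffness_eq, Matrix.sum_apply]

theorem strain_eq (rho delta : EuclideanSpace ℝ (Fin n)) (u : EuclideanSpace ℝ (Fin m)) :
    P.strain rho delta u = u.ofLp ⬝ᵥ (P.stiffness rho delta *ᵥ u.ofLp) := by
  simp [stiffness, localStiffness_eq, Matrix.sum_mulVec, dotProduct_sum, strain, energy,
    Matrix.smul_mulVec]

theorem J_eq (eps : ℝ) (rho : EuclideanSpace ℝ (Fin n))
    (y : EuclideanSpace ℝ (Fin n) × EuclideanSpace ℝ (Fin m)) :
    P.J eps rho y = 2 * (P.f.ofLp ⬝ᵥ y.2.ofLp) - P.strain rho y.1 y.2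
      - eps / 2 * ∑ e, y.1 e ^ 2 := by
  simp [J, strain, energy, localStiffness_eq, Matrix.smul_mulVec, EuclideanSpace.norm_sq_eq]

/-! ### Positivity -/

/-- The form is diagonal in `x 0 + x 1`, `x 0 - x 1`, `x 2`, with positive coefficients for `nu` in
the given range. -/
theorem unitTensor_nonneg {nu : ℝ} (h1 : -1 < nu) (h2 : nu < 1 / 2) (x : Fin 3 → ℝ) :
    0 ≤ x ⬝ᵥ (unitTensor nu *ᵥ x) := by
  have hx : x ⬝ᵥ (unitTensor nu *ᵥ x) = 1 / ((1 + nu) * (1 - 2 * nu)) *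
      (1 / 2 * (x 0 + x 1) ^ 2 + (1 - 2 * nu) / 2 * ((x 0 - x 1) ^ 2 + x 2 ^ 2)) := by
    rw [unitTensor, Matrix.smul_mulVec, dotProduct_smul, smul_eq_mul]
    congr 1
    simp [Matrix.mulVec, dotProduct, Fin.sum_univ_three]
    ring
  have h3 : 0 < 1 + nu := by linarith
  have h4 : 0 < 1 - 2 * nu := by linarith
  rw [hx]
  positivity

theorem energy_nonneg (e : Fin n) (u : EuclideanSpace ℝ (Fin m)) : 0 ≤ P.energy e u := by
  rw [energy, unitStiffness, Matrix.sum_mulVec, dotProduct_sum]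
  refine Finset.sum_nonneg fun l _ => ?_
  rw [← Matrix.mulVec_mulVec, ← Matrix.mulVec_mulVec, Matrix.dotProduct_mulVec,
    Matrix.vecMul_transpose]
  exact unitTensor_nonneg P.neg_one_lt_nu P.nu_lt_half _

/-- Only the shape of the expansion matters: `c` is the sum of both cross terms, so symmetry of the
matrix is not needed. -/
theorem energy_comb (e : Fin n) (u v : EuclideanSpace ℝ (Fin m)) : ∃ c, ∀ s t : ℝ,
    P.energy e (s • u + t • v) = s ^ 2 * P.energy e u + s * t * c + t ^ 2 * P.energy e v := by
  refine ⟨u.ofLp ⬝ᵥ (P.unitStiffness e *ᵥ v.ofLp) + v.ofLp ⬝ᵥ (P.unitStiffness e *ᵥ u.ofLp),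
    fun s t => ?_⟩
  simp only [energy, WithLp.ofLp_add, WithLp.ofLp_smul, Matrix.mulVec_add, Matrix.mulVec_smul,
    dotProduct_add, add_dotProduct, smul_dotProduct, dotProduct_smul, smul_eq_mul]
  ring

theorem young_eq (t : ℝ) : P.young t = (1 / P.E0 + (1 / P.ED - 1 / P.E0) * t)⁻¹ := by
  rw [young]; congr 1; ring

theorem E0_pos : 0 < P.E0 := P.ED_pos.trans P.ED_lt_E0

theorem young_den_pos {t : ℝ} (ht : 0 ≤ t) : 0 < 1 / P.E0 + (1 / P.ED - 1 / P.E0) * t := by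
  have h1 : 0 < 1 / P.E0 := one_div_pos.2 P.E0_pos
  have h2 : 0 < 1 / P.ED - 1 / P.E0 := sub_pos.2 (one_div_lt_one_div_of_lt P.ED_pos P.ED_lt_E0)
  positivity

theorem young_pos {t : ℝ} (ht : 0 ≤ t) : 0 < P.young t := by
  rw [young_eq]; exact inv_pos.2 (P.young_den_pos ht)

theorem young_one_le {t : ℝ} (h0 : 0 ≤ t) (h1 : t ≤ 1) : P.young 1 ≤ P.young t := by
  have h2 : 0 < 1 / P.ED - 1 / P.E0 := sub_pos.2 (one_div_lt_one_div_of_lt P.ED_pos P.ED_lt_E0)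
  rw [young_eq, young_eq]
  refine inv_anti₀ (P.young_den_pos h0) ?_
  gcongr

/-- With `a`, `b` the denominators of `E` at `s`, `t`, the convexity gap is exactly the energy of `b
u - a v` divided by `2ab(a + b)`. -/
theorem young_energy_midpoint (e : Fin n) {s t : ℝ} (hs : 0 ≤ s) (ht : 0 ≤ t)
    (u v : EuclideanSpace ℝ (Fin m)) :
    P.young ((1 / 2) * s + (1 / 2) * t) * P.energy e ((1 / 2 : ℝ) • u + (1 / 2 : ℝ) • v) ≤
      (1 / 2) * (P.young s * P.energy e u) + (1 / 2) * (P.young t * P.energy e v) := by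
  obtain ⟨c, hc⟩ := P.energy_comb e u v
  rw [hc, young_eq, young_eq, young_eq]
  have ha := P.young_den_pos hs
  have hb := P.young_den_pos ht
  set a := 1 / P.E0 + (1 / P.ED - 1 / P.E0) * s with ha'
  set b := 1 / P.E0 + (1 / P.ED - 1 / P.E0) * t with hb'
  have hab : 1 / P.E0 + (1 / P.ED - 1 / P.E0) * ((1 / 2) * s + (1 / 2) * t) = (a + b) / 2 := by
    rw [ha', hb']; ring
  rw [hab, ← sub_nonneg]
  have key := P.energy_nonneg e (b • u + (-a) • v)
  rw [hc] at key
  have : 1 / 2 * (a⁻¹ * P.energy e u) + 1 / 2 * (b⁻¹ * P.energy e v) -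
      ((a + b) / 2)⁻¹ * ((1 / 2) ^ 2 * P.energy e u + 1 / 2 * (1 / 2) * c +
        (1 / 2) ^ 2 * P.energy e v) =
      (b ^ 2 * P.energy e u + b * -a * c + (-a) ^ 2 * P.energy e v) / (2 * a * b * (a + b)) := by
    field_simp
    ring
  rw [this]
  positivity

theorem vol_pos (e : Fin n) : 0 < P.vol e :=
  ENNReal.toReal_pos (P.elem_pos e).ne' (P.elem_finite e).ne

theorem totalVol_pos (e : Fin n) : 0 < P.totalVol := by
  refine ENNReal.toReal_pos ?_ ?_
  · exact ((P.elem_pos e).trans_le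
      (MeasureTheory.measure_mono (Set.subset_iUnion P.elem e))).ne'
  · refine ((MeasureTheory.measure_iUnion_fintype_le _ _).trans_lt ?_).ne
    exact ENNReal.sum_lt_top.2 fun e _ => P.elem_finite e

theorem coef_pos {rho : EuclideanSpace ℝ (Fin n)} {e : Fin n} (h : 0 < P.filtered rho e) :
    0 < P.coef rho e := by
  have h1 := P.vol_pos e
  have h2 := P.totalVol_pos e
  have h3 := Real.rpow_pos_of_pos h P.p
  unfold coef
  positivity

theorem weight_nonneg (e j : Fin n) : 0 ≤ P.weight e j :=
  MeasureTheory.integral_nonneg fun _ => P.kernel_nonneg _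

theorem weight_sum_pos (e : Fin n) : 0 < ∑ j ∈ P.nbhd e, P.weight e j := P.kernel_mass_pos e

theorem filtered_pos {rho : EuclideanSpace ℝ (Fin n)} (h : rho ∈ P.Uad) (e : Fin n) :
    0 < P.filtered rho e := by
  refine div_pos ?_ (P.weight_sum_pos e)
  refine (mul_pos P.rhoMin_pos (P.weight_sum_pos e)).trans_le ?_
  rw [Finset.mul_sum]
  exact Finset.sum_le_sum fun j _ => mul_le_mul_of_nonneg_right (h.1 j).1 (P.weight_nonneg e j)

/-! ### Smoothness -/

theorem contDiff_filtered (e : Fin n) {k : WithTop ℕ∞} :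
    ContDiff ℝ k fun rho => P.filtered rho e := by
  unfold filtered
  fun_prop

theorem contDiffAt_filtered_rpow {rho : EuclideanSpace ℝ (Fin n)} {e : Fin n}
    (h : 0 < P.filtered rho e) {k : WithTop ℕ∞} :
    ContDiffAt ℝ k (fun r => P.filtered r e ^ P.p) rho :=
  (P.contDiff_filtered e).contDiffAt.rpow_const_of_ne h.ne'

theorem contDiffAt_coef {rho : EuclideanSpace ℝ (Fin n)} {e : Fin n}
    (h : 0 < P.filtered rho e) {k : WithTop ℕ∞} :
    ContDiffAt ℝ k (fun r => P.coef r e) rho :=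
  (contDiffAt_const.mul (P.contDiffAt_filtered_rpow h)).div_const _

theorem contDiffAt_young {t : ℝ} (h : 0 ≤ t) {k : WithTop ℕ∞} : ContDiffAt ℝ k P.young t := by
  have : P.young = fun t => (1 / P.E0 + (1 / P.ED - 1 / P.E0) * t)⁻¹ := funext P.young_eq
  rw [this]
  exact ContDiffAt.inv (by fun_prop) (P.young_den_pos h).ne'

theorem contDiff_energy (e : Fin n) {k : WithTop ℕ∞} : ContDiff ℝ k (P.energy e) := by
  unfold energy Matrix.mulVec dotProduct
  fun_prop

theorem contDiffAt_budget {rho delta : EuclideanSpace ℝ (Fin n)}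
    (h : ∀ e, 0 < P.filtered rho e) {k : WithTop ℕ∞} :
    ContDiffAt ℝ k (fun x : EuclideanSpace ℝ (Fin n) × EuclideanSpace ℝ (Fin n) =>
      P.budget x.1 x.2) (rho, delta) := by
  simp only [budget_eq]
  refine ContDiffAt.sum fun e _ => ContDiffAt.mul ?_ (by fun_prop)
  exact (P.contDiffAt_coef (h e)).comp (rho, delta) contDiffAt_fst

theorem contDiffAt_J (eps : ℝ) {rho : EuclideanSpace ℝ (Fin n)}
    {y : EuclideanSpace ℝ (Fin n) × EuclideanSpace ℝ (Fin m)}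
    (h : ∀ e, 0 < P.filtered rho e) (hy : ∀ e, 0 ≤ y.1 e) {k : WithTop ℕ∞} :
    ContDiffAt ℝ k (fun x : EuclideanSpace ℝ (Fin n) ×
      EuclideanSpace ℝ (Fin n) × EuclideanSpace ℝ (Fin m) => P.J eps x.1 x.2) (rho, y) := by
  simp only [J_eq, strain]
  refine ((ContDiffAt.sub ?_ ?_)).sub ?_
  · unfold dotProduct
    fun_prop
  · refine ContDiffAt.sum fun e _ => (ContDiffAt.mul ?_ ?_).mul ?_
    · exact (P.contDiffAt_filtered_rpow (h e)).comp (rho, y) contDiffAt_fst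
    · exact (P.contDiffAt_young (hy e)).comp (rho, y)
        (f := fun x : EuclideanSpace ℝ (Fin n) ×
          EuclideanSpace ℝ (Fin n) × EuclideanSpace ℝ (Fin m) => x.2.1 e) (by fun_prop)
    · exact (P.contDiff_energy e).contDiffAt.comp (rho, y)
        (f := fun x : EuclideanSpace ℝ (Fin n) ×
          EuclideanSpace ℝ (Fin n) × EuclideanSpace ℝ (Fin m) => x.2.2) (by fun_prop)
  · fun_prop

/-! ### Coercivity of the strain energy -/

/-- Densities with positive filtered density at which the strain energy is coercive with
constant `kappa`, uniformly in the uncertainty. -/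
def coerciveSet (kappa : ℝ) : Set (EuclideanSpace ℝ (Fin n)) :=
  {rho | (∀ e, 0 < P.filtered rho e) ∧ ∀ delta : EuclideanSpace ℝ (Fin n),
    (∀ e, 0 ≤ delta e ∧ delta e ≤ 1) → ∀ u, kappa * ‖u‖ ^ 2 ≤ P.strain rho delta u}

theorem energy_smul (e : Fin n) (s : ℝ) (u : EuclideanSpace ℝ (Fin m)) :
    P.energy e (s • u) = s ^ 2 * P.energy e u := by
  obtain ⟨c, hc⟩ := P.energy_comb e u u
  simpa using hc s 0

theorem strain_smul (rho delta : EuclideanSpace ℝ (Fin n)) (s : ℝ)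
    (u : EuclideanSpace ℝ (Fin m)) :
    P.strain rho delta (s • u) = s ^ 2 * P.strain rho delta u := by
  simp only [strain, energy_smul, Finset.mul_sum]
  exact Finset.sum_congr rfl fun e _ => by ring

theorem strain_zero (rho delta : EuclideanSpace ℝ (Fin n)) : P.strain rho delta 0 = 0 := by
  simpa using P.strain_smul rho delta 0 0

theorem continuous_strain (rho delta : EuclideanSpace ℝ (Fin n)) :
    Continuous (P.strain rho delta) := by
  unfold strain
  exact continuous_finsetSum _ fun e _ =>
    continuous_const.mul (P.contDiff_energy e (k := 0)).continuous

theorem exists_coercive_of_pos {rho delta : EuclideanSpace ℝ (Fin n)}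
    (h : ∀ u, u ≠ 0 → 0 < P.strain rho delta u) :
    ∃ kappa > 0, ∀ u, kappa * ‖u‖ ^ 2 ≤ P.strain rho delta u := by
  -- The sphere is empty when `m = 0`; any constant works then.
  rcases (Metric.sphere (0 : EuclideanSpace ℝ (Fin m)) 1).eq_empty_or_nonempty with hs | hs
  · refine ⟨1, one_pos, fun u => ?_⟩
    by_cases hu : u = 0
    · simp [hu, strain_zero]
    · have : ‖u‖⁻¹ • u ∈ Metric.sphere (0 : EuclideanSpace ℝ (Fin m)) 1 := by
        simp [norm_smul, hu]
      simp [hs] at this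
  · obtain ⟨v, hv, hmin⟩ := (isCompact_sphere (0 : EuclideanSpace ℝ (Fin m)) 1).exists_isMinOn hs
      (P.continuous_strain rho delta).continuousOn
    have hv0 : v ≠ 0 := by
      rintro rfl
      simp at hv
    refine ⟨_, h v hv0, fun u => ?_⟩
    by_cases hu : u = 0
    · simp [hu, strain_zero]
    · have h1 : ‖u‖⁻¹ • u ∈ Metric.sphere (0 : EuclideanSpace ℝ (Fin m)) 1 := by
        simp [norm_smul, hu]
      have h2 : P.strain rho delta v ≤ P.strain rho delta (‖u‖⁻¹ • u) := hmin h1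
      rw [strain_smul] at h2
      have h3 : 0 < ‖u‖ := norm_pos_iff.2 hu
      calc P.strain rho delta v * ‖u‖ ^ 2
          ≤ ‖u‖⁻¹ ^ 2 * P.strain rho delta u * ‖u‖ ^ 2 := by gcongr
        _ = P.strain rho delta u := by field_simp

/-- The structure is softest at `δ = 1`, since `E` decreases on `[0,1]`, so positive definiteness
there bounds the strain energy for all `δ` at once. Near `rhoBar` each factor `ρ̃_e^p` keeps more
than half its value, hence `k / 2`. The nearby densities need not be admissible. -/
theorem exists_eventually_mem_coerciveSet {rhoBar : EuclideanSpace ℝ (Fin n)}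
    (hrho : rhoBar ∈ P.Uad) (hK : ∀ delta : EuclideanSpace ℝ (Fin n),
      (∀ e, 0 ≤ delta e ∧ delta e ≤ 1) → (P.stiffness rhoBar delta).PosDef) :
    ∃ kappa > 0, ∀ᶠ rho in 𝓝 rhoBar, rho ∈ P.coerciveSet kappa := by
  have hpos := hK (WithLp.toLp 2 fun _ => 1) (by simp)
  obtain ⟨k, hk, hle⟩ := P.exists_coercive_of_pos (rho := rhoBar)
    (delta := WithLp.toLp 2 fun _ => 1) fun u hu => by
      rw [strain_eq]
      simpa using hpos.dotProduct_mulVec_pos (x := u.ofLp) (by simpa using hu)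
  refine ⟨k / 2, by positivity, ?_⟩
  have h1 : ∀ᶠ rho in 𝓝 rhoBar, ∀ e, 0 < P.filtered rho e ∧
      P.filtered rhoBar e ^ P.p / 2 < P.filtered rho e ^ P.p := by
    refine Filter.eventually_all.2 fun e => ?_
    have hf := P.filtered_pos hrho e
    refine Filter.Eventually.and ?_ ?_
    · exact (P.contDiff_filtered e (k := 0)).continuous.continuousAt.eventually_const_lt hf
    · exact (P.contDiffAt_filtered_rpow hf (k := 0)).continuousAt.eventually_const_lt
        (half_lt_self (Real.rpow_pos_of_pos hf _))
  filter_upwards [h1] with rho h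
  refine ⟨fun e => (h e).1, fun delta hd u => ?_⟩
  have h2 : P.strain rhoBar (WithLp.toLp 2 fun _ => 1) u / 2 ≤ P.strain rho delta u := by
    rw [strain, strain, Finset.sum_div]
    refine Finset.sum_le_sum fun e _ => ?_
    have hE := P.energy_nonneg e u
    have hy := P.young_one_le (hd e).1 (hd e).2
    have hy1 := P.young_pos zero_le_one
    have hw := Real.rpow_pos_of_pos (h e).1 P.p
    calc P.filtered rhoBar e ^ P.p * P.young 1 * P.energy e u / 2
        = P.filtered rhoBar e ^ P.p / 2 * P.young 1 * P.energy e u := by ring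
      _ ≤ P.filtered rho e ^ P.p * P.young (delta e) * P.energy e u := by
        gcongr
        exact (h e).2.le
  linarith [hle u]

/-! ### Existence and uniqueness of maximizers -/

theorem mem_feasible {rho : EuclideanSpace ℝ (Fin n)}
    {y : EuclideanSpace ℝ (Fin n) × EuclideanSpace ℝ (Fin m)} :
    y ∈ ParamProgram.feasible G P.H rho ↔ y.1 ∈ P.DeltaAd rho := by
  rw [feasible_eq]; simp

/-- Beyond this radius the quadratic loss `κ‖u‖²` exceeds the gain `2‖f‖‖u‖` from the load.
Maximization over all displacements thereby reduces to a ball. -/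
theorem J_lt_J_zero {kappa eps : ℝ} (hk : 0 < kappa) {rho delta : EuclideanSpace ℝ (Fin n)}
    (hrho : rho ∈ P.coerciveSet kappa) (hd : ∀ e, 0 ≤ delta e ∧ delta e ≤ 1)
    {u : EuclideanSpace ℝ (Fin m)} (hu : 2 * ‖P.f‖ / kappa < ‖u‖) :
    P.J eps rho (delta, u) < P.J eps rho (delta, 0) := by
  have h1 := hrho.2 delta hd u
  have h2 : P.f.ofLp ⬝ᵥ u.ofLp ≤ ‖P.f‖ * ‖u‖ := by
    have := real_inner_le_norm P.f u
    rwa [EuclideanSpace.inner_eq_star_dotProduct, star_trivial, dotProduct_comm] at this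
  have h3 : 0 < ‖u‖ := lt_of_le_of_lt (by positivity) hu
  rw [div_lt_iff₀ hk] at hu
  have h4 : 2 * ‖P.f‖ * ‖u‖ < ‖u‖ * kappa * ‖u‖ := by gcongr
  simp only [J_eq, strain_zero, WithLp.ofLp_zero, dotProduct_zero]
  nlinarith

theorem norm_le_of_mem_maximizers {kappa eps : ℝ} (hk : 0 < kappa)
    {rho : EuclideanSpace ℝ (Fin n)} (hrho : rho ∈ P.coerciveSet kappa)
    {y : EuclideanSpace ℝ (Fin n) × EuclideanSpace ℝ (Fin m)}
    (hy : y ∈ ParamProgram.maximizers (P.J eps) G P.H rho) : ‖y.2‖ ≤ 2 * ‖P.f‖ / kappa := by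
  by_contra! h
  have h1 := P.mem_feasible.1 hy.1
  exact (P.J_lt_J_zero hk hrho h1.1 h).not_ge (hy.2 (y.1, 0) (P.mem_feasible.2 h1))

theorem isCompact_unitBox : IsCompact {delta : EuclideanSpace ℝ (Fin n) |
    ∀ e, 0 ≤ delta e ∧ delta e ≤ 1} := by
  have h : IsCompact (WithLp.toLp 2 '' Set.Icc (0 : Fin n → ℝ) 1) :=
    isCompact_Icc.image (PiLp.continuous_toLp 2 _)
  convert h using 1
  ext d
  constructor
  · intro hd
    exact ⟨d.ofLp, ⟨fun e => (hd e).1, fun e => (hd e).2⟩, rfl⟩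
  · rintro ⟨x, hx, rfl⟩ e
    exact ⟨hx.1 e, hx.2 e⟩

theorem continuous_budget (rho : EuclideanSpace ℝ (Fin n)) : Continuous (P.budget rho) := by
  unfold budget
  fun_prop

theorem continuousAt_J {eps : ℝ} {rho : EuclideanSpace ℝ (Fin n)}
    (h : ∀ e, 0 < P.filtered rho e)
    {y : EuclideanSpace ℝ (Fin n) × EuclideanSpace ℝ (Fin m)} (hy : ∀ e, 0 ≤ y.1 e) :
    ContinuousAt (P.J eps rho) y :=
  ((P.contDiffAt_J eps h hy (k := 0)).continuousAt).comp
    (f := fun y => (rho, y)) (by fun_prop)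

theorem maximizers_nonempty {kappa eps : ℝ} (hk : 0 < kappa)
    {rho : EuclideanSpace ℝ (Fin n)} (hrho : rho ∈ P.coerciveSet kappa)
    (hne : (P.DeltaAd rho).Nonempty) :
    (ParamProgram.maximizers (P.J eps) G P.H rho).Nonempty := by
  set M := 2 * ‖P.f‖ / kappa
  have hM : 0 ≤ M := by positivity
  have hc : IsCompact (P.DeltaAd rho ×ˢ
      Metric.closedBall (0 : EuclideanSpace ℝ (Fin m)) M) := by
    refine IsCompact.prod ?_ (isCompact_closedBall _ _)
    exact isCompact_unitBox.inter_right (isClosed_eq (P.continuous_budget rho) continuous_const)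
  obtain ⟨d, hd⟩ := hne
  obtain ⟨y, hy, hmax⟩ := hc.exists_isMaxOn ⟨(d, 0), hd, by simpa using hM⟩
    (f := P.J eps rho)
    fun y hy => (P.continuousAt_J hrho.1 fun e => (hy.1.1 e).1).continuousWithinAt
  refine ⟨y, P.mem_feasible.2 hy.1, fun w hw => ?_⟩
  rw [mem_feasible] at hw
  by_cases h : ‖w.2‖ ≤ M
  · exact hmax ⟨hw, by simpa using h⟩
  · have h1 : P.J eps rho (w.1, 0) ≤ P.J eps rho y := hmax ⟨hw, by simpa using hM⟩
    exact (P.J_lt_J_zero hk hrho hw.1 (not_le.1 h)).le.trans h1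

theorem convex_feasible (rho : EuclideanSpace ℝ (Fin n)) :
    Convex ℝ (ParamProgram.feasible (G (m := m)) P.H rho) := by
  intro y hy w hw a b ha hb hab
  rw [mem_feasible] at *
  refine ⟨fun e => ?_, ?_⟩
  · have h1 := hy.1 e
    have h2 := hw.1 e
    have h3 : (a • y + b • w).1 e = a * y.1 e + b * w.1 e := by simp
    rw [h3]
    constructor
    · exact add_nonneg (mul_nonneg ha h1.1) (mul_nonneg hb h2.1)
    · calc a * y.1 e + b * w.1 e ≤ a * 1 + b * 1 := by gcongr <;> simp [h1, h2]
        _ = 1 := by linarith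
  · have h1 : P.budget rho (a • y + b • w).1 = a * P.budget rho y.1 + b * P.budget rho w.1 := by
      simp only [budget_eq, Finset.mul_sum, ← Finset.sum_add_distrib]
      exact Finset.sum_congr rfl fun e _ => by simp; ring
    rw [h1, hy.2, hw.2, ← add_mul, hab, one_mul]

theorem J_midpoint {eps : ℝ} {rho : EuclideanSpace ℝ (Fin n)}
    (h : ∀ e, 0 < P.filtered rho e)
    {y w : EuclideanSpace ℝ (Fin n) × EuclideanSpace ℝ (Fin m)} (hy : ∀ e, 0 ≤ y.1 e)
    (hw : ∀ e, 0 ≤ w.1 e) :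
    (1 / 2) * P.J eps rho y + (1 / 2) * P.J eps rho w + eps / 8 * ∑ e, (y.1 e - w.1 e) ^ 2 ≤
      P.J eps rho ((1 / 2 : ℝ) • y + (1 / 2 : ℝ) • w) := by
  have h1 : P.strain rho ((1 / 2 : ℝ) • y + (1 / 2 : ℝ) • w).1
      ((1 / 2 : ℝ) • y + (1 / 2 : ℝ) • w).2 ≤
      (1 / 2) * P.strain rho y.1 y.2 + (1 / 2) * P.strain rho w.1 w.2 := by
    simp only [strain, Finset.mul_sum, ← Finset.sum_add_distrib]
    refine Finset.sum_le_sum fun e _ => ?_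
    have h2 := P.young_energy_midpoint e (hy e) (hw e) y.2 w.2
    have h3 := Real.rpow_pos_of_pos (h e) P.p
    calc _ = P.filtered rho e ^ P.p * (P.young ((1 / 2) * y.1 e + (1 / 2) * w.1 e) *
          P.energy e ((1 / 2 : ℝ) • y.2 + (1 / 2 : ℝ) • w.2)) := by simp; ring
      _ ≤ P.filtered rho e ^ P.p * ((1 / 2) * (P.young (y.1 e) * P.energy e y.2) +
          (1 / 2) * (P.young (w.1 e) * P.energy e w.2)) := by gcongr
      _ = _ := by ring
  have h2 : ∑ e, ((1 / 2 : ℝ) • y + (1 / 2 : ℝ) • w).1 e ^ 2 = (1 / 2) * ∑ e, y.1 e ^ 2 +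
      (1 / 2) * ∑ e, w.1 e ^ 2 - (1 / 4) * ∑ e, (y.1 e - w.1 e) ^ 2 := by
    simp only [Finset.mul_sum, ← Finset.sum_add_distrib, ← Finset.sum_sub_distrib]
    exact Finset.sum_congr rfl fun e _ => by simp; ring
  have h3 : P.f.ofLp ⬝ᵥ ((1 / 2 : ℝ) • y + (1 / 2 : ℝ) • w).2.ofLp =
      (1 / 2) * (P.f.ofLp ⬝ᵥ y.2.ofLp) + (1 / 2) * (P.f.ofLp ⬝ᵥ w.2.ofLp) := by
    simp
  rw [J_eq, J_eq, J_eq, h2, h3]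
  linarith

theorem strain_midpoint (rho delta : EuclideanSpace ℝ (Fin n))
    (u v : EuclideanSpace ℝ (Fin m)) :
    P.strain rho delta ((1 / 2 : ℝ) • u + (1 / 2 : ℝ) • v) =
      (1 / 2) * P.strain rho delta u + (1 / 2) * P.strain rho delta v -
        (1 / 4) * P.strain rho delta (u - v) := by
  simp only [strain, Finset.mul_sum, ← Finset.sum_add_distrib, ← Finset.sum_sub_distrib]
  refine Finset.sum_congr rfl fun e _ => ?_
  obtain ⟨c, hc⟩ := P.energy_comb e u v
  have h1 := hc 1 (-1)
  rw [one_smul, neg_one_smul, ← sub_eq_add_neg] at h1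
  rw [hc, h1]
  ring

/-- The midpoint of two maximizers is feasible and cannot do better, so the `ε`-gap in `J_midpoint`
forces equal `δ`. With `δ` fixed, the parallelogram gap in `strain_midpoint` and coercivity force
equal `u`. -/
theorem maximizers_subsingleton {kappa eps : ℝ} (hk : 0 < kappa) (heps : 0 < eps)
    {rho : EuclideanSpace ℝ (Fin n)} (hrho : rho ∈ P.coerciveSet kappa) :
    (ParamProgram.maximizers (P.J eps) G P.H rho).Subsingleton := by
  intro y hy w hw
  have hyf := P.mem_feasible.1 hy.1
  have hwf := P.mem_feasible.1 hw.1
  have hfe := P.convex_feasible rho hy.1 hw.1 (a := 1 / 2) (b := 1 / 2) (by norm_num)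
    (by norm_num) (by norm_num)
  have h1 := hy.2 w hw.1
  have h2 := hw.2 y hy.1
  have h3 := hy.2 _ hfe
  have h4 := P.J_midpoint hrho.1 (eps := eps) (fun e => (hyf.1 e).1) (fun e => (hwf.1 e).1)
  have h5 : ∑ e, (y.1 e - w.1 e) ^ 2 = 0 := by
    refine le_antisymm ?_ (Finset.sum_nonneg fun e _ => sq_nonneg _)
    by_contra! h
    have : 0 < eps / 8 * ∑ e, (y.1 e - w.1 e) ^ 2 := by positivity
    linarith
  have h6 : y.1 = w.1 := by
    ext e
    have := (Finset.sum_eq_zero_iff_of_nonneg fun e _ => sq_nonneg _).1 h5 e (Finset.mem_univ e)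
    exact sub_eq_zero.1 (pow_eq_zero_iff two_ne_zero |>.1 this)
  obtain ⟨d, u⟩ := y
  obtain ⟨d', v⟩ := w
  obtain rfl : d = d' := h6
  have h7 := hrho.2 d hyf.1 (u - v)
  have h8 : (1 / 2 : ℝ) • (d, u) + (1 / 2 : ℝ) • (d, v) =
      (d, (1 / 2 : ℝ) • u + (1 / 2 : ℝ) • v) := by
    ext i
    · simp; ring
    · simp
  rw [h8] at h3
  simp only [J_eq, strain_midpoint, WithLp.ofLp_add, WithLp.ofLp_smul, dotProduct_add,
    dotProduct_smul, smul_eq_mul] at h1 h2 h3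
  have h9 : kappa * ‖u - v‖ ^ 2 ≤ 0 := by linarith
  have h10 : ‖u - v‖ = 0 := by
    by_contra h
    have : 0 < ‖u - v‖ := lt_of_le_of_ne (norm_nonneg _) (Ne.symm h)
    exact absurd h9 (not_le.2 (by positivity))
  rw [sub_eq_zero.1 (norm_eq_zero.1 h10)]

/-! ### Restoring the budget constraint through a free coordinate -/

/-- Change the coordinate `e` of `delta` so that the budget constraint at `rho` holds. -/
def restore (e : Fin n) (rho delta : EuclideanSpace ℝ (Fin n)) : EuclideanSpace ℝ (Fin n) :=
  delta + ((P.D - P.budget rho delta) / P.coef rho e) • EuclideanSpace.single e 1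

theorem restore_of_budget_eq {e : Fin n} {rho delta : EuclideanSpace ℝ (Fin n)}
    (h : P.budget rho delta = P.D) : P.restore e rho delta = delta := by
  simp [restore, h]

theorem budget_restore {e : Fin n} {rho : EuclideanSpace ℝ (Fin n)} (h : 0 < P.filtered rho e)
    (delta : EuclideanSpace ℝ (Fin n)) : P.budget rho (P.restore e rho delta) = P.D := by
  have hc := (P.coef_pos h).ne'
  have : P.budget rho (P.restore e rho delta) = P.budget rho delta +
      P.coef rho e * ((P.D - P.budget rho delta) / P.coef rho e) := by
    rw [budget_eq, restore, budget_eq]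
    simp [mul_add, Finset.sum_add_distrib]
  rw [this, mul_div_cancel₀ _ hc]
  ring

theorem restore_mem_DeltaAd {e : Fin n} {rho delta : EuclideanSpace ℝ (Fin n)}
    (h : 0 < P.filtered rho e) (hd : ∀ i, 0 ≤ delta i ∧ delta i ≤ 1)
    (he : 0 < P.restore e rho delta e ∧ P.restore e rho delta e < 1) :
    P.restore e rho delta ∈ P.DeltaAd rho := by
  refine ⟨fun i => ?_, P.budget_restore h delta⟩
  by_cases hi : i = e
  · subst hi
    exact ⟨he.1.le, he.2.le⟩
  · have : P.restore e rho delta i = delta i := by simp [restore, hi]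
    rw [this]
    exact hd i

theorem contDiffAt_restore {e : Fin n} {rho delta : EuclideanSpace ℝ (Fin n)}
    (h : ∀ i, 0 < P.filtered rho i) {k : WithTop ℕ∞} :
    ContDiffAt ℝ k (fun x : EuclideanSpace ℝ (Fin n) × EuclideanSpace ℝ (Fin n) =>
      P.restore e x.1 x.2) (rho, delta) := by
  have h1 : ContDiffAt ℝ k (fun x : EuclideanSpace ℝ (Fin n) × EuclideanSpace ℝ (Fin n) =>
      P.coef x.1 e) (rho, delta) :=
    (P.contDiffAt_coef (h e)).comp (rho, delta) contDiffAt_fst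
  have h2 : ContDiffAt ℝ k (fun x : EuclideanSpace ℝ (Fin n) × EuclideanSpace ℝ (Fin n) =>
      (P.D - P.budget x.1 x.2) / P.coef x.1 e) (rho, delta) :=
    (contDiffAt_const.sub (P.contDiffAt_budget h)).div h1 (P.coef_pos (h e)).ne'
  unfold restore
  exact contDiffAt_snd.add (h2.smul contDiffAt_const)

/-- The objective after elimination of the budget constraint. -/
def reducedJ (eps : ℝ) (e : Fin n) (x : EuclideanSpace ℝ (Fin n) ×
    EuclideanSpace ℝ (Fin n) × EuclideanSpace ℝ (Fin m)) : ℝ :=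
  P.J eps x.1 (P.restore e x.1 x.2.1, x.2.2)

/-- Smoothness is claimed at feasible points only: there `restore` changes nothing, so `E` is
evaluated at nonnegative arguments, away from its pole. -/
theorem contDiffAt_reducedJ (eps : ℝ) {e : Fin n} {rho : EuclideanSpace ℝ (Fin n)}
    {y : EuclideanSpace ℝ (Fin n) × EuclideanSpace ℝ (Fin m)}
    (h : ∀ i, 0 < P.filtered rho i) (hy : y.1 ∈ P.DeltaAd rho) {k : WithTop ℕ∞} :
    ContDiffAt ℝ k (P.reducedJ eps e) (rho, y) := by
  have h1 : ContDiffAt ℝ k (fun x : EuclideanSpace ℝ (Fin n) ×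
      EuclideanSpace ℝ (Fin n) × EuclideanSpace ℝ (Fin m) => P.restore e x.1 x.2.1) (rho, y) :=
    (P.contDiffAt_restore h).comp (rho, y) (f := fun x : EuclideanSpace ℝ (Fin n) ×
      EuclideanSpace ℝ (Fin n) × EuclideanSpace ℝ (Fin m) => (x.1, x.2.1)) (by fun_prop)
  have h2 : ContDiffAt ℝ k (fun x : EuclideanSpace ℝ (Fin n) ×
      EuclideanSpace ℝ (Fin n) × EuclideanSpace ℝ (Fin m) =>
      (x.1, (P.restore e x.1 x.2.1, x.2.2))) (rho, y) :=
    contDiffAt_fst.prodMk (h1.prodMk (by fun_prop))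
  have h3 : ContDiffAt ℝ k (fun x : EuclideanSpace ℝ (Fin n) ×
      EuclideanSpace ℝ (Fin n) × EuclideanSpace ℝ (Fin m) => P.J eps x.1 x.2)
      (rho, (P.restore e rho y.1, y.2)) := by
    rw [P.restore_of_budget_eq hy.2]
    exact P.contDiffAt_J eps h fun i => (hy.1 i).1
  exact ContDiffAt.comp (rho, y) (f := fun x : EuclideanSpace ℝ (Fin n) ×
      EuclideanSpace ℝ (Fin n) × EuclideanSpace ℝ (Fin m) =>
      (x.1, (P.restore e x.1 x.2.1, x.2.2))) h3 h2

/-- At `(rho, delta)` itself the restoration is trivial, so continuity keeps the coordinate `e`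
strictly inside `(0,1)`. The general filter `l` serves ultrafilters, `𝓝 rho` and `𝓝 (x, x)` alike.
-/
theorem eventually_restore_free {α : Type*} {l : Filter α} {e : Fin n}
    {rho delta : EuclideanSpace ℝ (Fin n)} (h : ∀ i, 0 < P.filtered rho i)
    (hd : delta ∈ P.DeltaAd rho) (he : 0 < delta e ∧ delta e < 1)
    {r d : α → EuclideanSpace ℝ (Fin n)} (hr : Filter.Tendsto r l (𝓝 rho))
    (hdl : Filter.Tendsto d l (𝓝 delta)) :
    ∀ᶠ a in l, 0 < P.restore e (r a) (d a) e ∧ P.restore e (r a) (d a) e < 1 := by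
  have h1 := (P.contDiffAt_restore (e := e) h (k := 0) (delta := delta)).continuousAt.tendsto.comp
    (hr.prodMk_nhds hdl)
  rw [P.restore_of_budget_eq hd.2] at h1
  have h2 : Filter.Tendsto (fun a => P.restore e (r a) (d a) e) l (𝓝 (delta e)) :=
    ((EuclideanSpace.proj (𝕜 := ℝ) e).continuous.tendsto delta).comp h1
  exact (h2.eventually_const_lt he.1).and (h2.eventually_lt_const he.2)

/-! ### Continuity of the maximizer -/

/-- The maximizers stay in a fixed compact set, so along any ultrafilter `z` has a limit `y`. It is
feasible and, by comparison with restored copies of `z rho`, optimal; uniqueness gives `y = z rho`.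
-/
theorem continuousAt_maximizer {kappa eps : ℝ} (hk : 0 < kappa) (heps : 0 < eps)
    {rho : EuclideanSpace ℝ (Fin n)} {e : Fin n}
    {z : EuclideanSpace ℝ (Fin n) → EuclideanSpace ℝ (Fin n) × EuclideanSpace ℝ (Fin m)}
    (hc : ∀ᶠ r in 𝓝 rho, r ∈ P.coerciveSet kappa)
    (hz : ∀ᶠ r in 𝓝 rho, z r ∈ ParamProgram.maximizers (P.J eps) G P.H r)
    (he : 0 < (z rho).1 e ∧ (z rho).1 e < 1) : ContinuousAt z rho := by
  have hc0 := hc.self_of_nhds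
  have hz0 := hz.self_of_nhds
  have hzf := P.mem_feasible.1 hz0.1
  rw [ContinuousAt, Filter.tendsto_iff_ultrafilter]
  intro l hl
  have hS : IsCompact ({delta : EuclideanSpace ℝ (Fin n) | ∀ e, 0 ≤ delta e ∧ delta e ≤ 1} ×ˢ
      Metric.closedBall (0 : EuclideanSpace ℝ (Fin m)) (2 * ‖P.f‖ / kappa)) :=
    isCompact_unitBox.prod (isCompact_closedBall _ _)
  have hmem : ∀ᶠ r in (l : Filter _), z r ∈
      {delta : EuclideanSpace ℝ (Fin n) | ∀ e, 0 ≤ delta e ∧ delta e ≤ 1} ×ˢ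
      Metric.closedBall (0 : EuclideanSpace ℝ (Fin m)) (2 * ‖P.f‖ / kappa) := by
    filter_upwards [hl hc, hl hz] with r h1 h2
    exact ⟨(P.mem_feasible.1 h2.1).1, by simpa using P.norm_le_of_mem_maximizers hk h1 h2⟩
  obtain ⟨y, hyS, hy⟩ := hS.ultrafilter_le_nhds' (l.map z) hmem
  have hyt : Filter.Tendsto z l (𝓝 y) := hy
  have hlt : Filter.Tendsto (fun r => r) (l : Filter _) (𝓝 rho) := hl
  have hyb : P.budget rho y.1 = P.D := by
    have h1 : Filter.Tendsto (fun r => P.budget r (z r).1) l (𝓝 (P.budget rho y.1)) :=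
      Filter.Tendsto.comp (f := fun r => (r, (z r).1))
        (g := fun x : EuclideanSpace ℝ (Fin n) × EuclideanSpace ℝ (Fin n) => P.budget x.1 x.2)
        (P.contDiffAt_budget (delta := y.1) hc0.1 (k := 0)).continuousAt.tendsto
        (hlt.prodMk_nhds ((continuous_fst.tendsto y).comp hyt))
    refine tendsto_nhds_unique (h1.congr' ?_) tendsto_const_nhds
    filter_upwards [hl hz] with r h2 using (P.mem_feasible.1 h2.1).2
  have hle : P.J eps rho (z rho) ≤ P.J eps rho y := by
    have h1 : Filter.Tendsto (fun r => P.J eps r (z r)) l (𝓝 (P.J eps rho y)) :=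
      Filter.Tendsto.comp (f := fun r => (r, z r))
        (g := fun x : EuclideanSpace ℝ (Fin n) ×
          EuclideanSpace ℝ (Fin n) × EuclideanSpace ℝ (Fin m) => P.J eps x.1 x.2)
        (P.contDiffAt_J eps (y := y) hc0.1 (fun i => (hyS.1 i).1)
          (k := 0)).continuousAt.tendsto (hlt.prodMk_nhds hyt)
    -- The competitor at density `r` is `z rho` with its budget restored; its values tend to the
    -- optimal value at `rho`.
    have h2 : Filter.Tendsto (fun r => P.reducedJ eps e (r, z rho)) l
        (𝓝 (P.reducedJ eps e (rho, z rho))) :=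
      Filter.Tendsto.comp (f := fun r => (r, z rho)) (g := P.reducedJ eps e)
        (P.contDiffAt_reducedJ eps (y := z rho) hc0.1 hzf (k := 0)).continuousAt.tendsto
        (hlt.prodMk_nhds tendsto_const_nhds)
    rw [reducedJ, P.restore_of_budget_eq hzf.2] at h2
    refine le_of_tendsto_of_tendsto h2 h1 ?_
    have h3 := P.eventually_restore_free hc0.1 hzf he hlt tendsto_const_nhds
    filter_upwards [hl hz, hl hc, h3] with r h4 h5 h6
    exact h4.2 _ (P.mem_feasible.2 (P.restore_mem_DeltaAd (h5.1 e) hzf.1 h6))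
  have hymax : y ∈ ParamProgram.maximizers (P.J eps) G P.H rho :=
    ⟨P.mem_feasible.2 ⟨hyS.1, hyb⟩, fun w hw => (hz0.2 w hw).trans hle⟩
  rwa [P.maximizers_subsingleton hk heps hc0 hz0 hymax]

/-! ### The constraint qualification and the multipliers -/

theorem fderiv_G_inl (rho : EuclideanSpace ℝ (Fin n))
    (y : EuclideanSpace ℝ (Fin n) × EuclideanSpace ℝ (Fin m)) (e : Fin n) :
    fderiv ℝ (fun z => G rho z (Sum.inl e)) y =
      -((EuclideanSpace.proj (𝕜 := ℝ) e).comp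
        (ContinuousLinearMap.fst ℝ _ (EuclideanSpace ℝ (Fin m)))) :=
  (-((EuclideanSpace.proj (𝕜 := ℝ) e).comp
    (ContinuousLinearMap.fst ℝ _ (EuclideanSpace ℝ (Fin m))))).hasFDerivAt.fderiv

theorem fderiv_G_inr (rho : EuclideanSpace ℝ (Fin n))
    (y : EuclideanSpace ℝ (Fin n) × EuclideanSpace ℝ (Fin m)) (e : Fin n) :
    fderiv ℝ (fun z => G rho z (Sum.inr e)) y =
      (EuclideanSpace.proj e).comp (ContinuousLinearMap.fst ℝ _ _) :=
  (((EuclideanSpace.proj (𝕜 := ℝ) e).comp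
    (ContinuousLinearMap.fst ℝ _ (EuclideanSpace ℝ (Fin m)))).hasFDerivAt.sub_const 1).fderiv

theorem fderiv_H (rho : EuclideanSpace ℝ (Fin n))
    (y : EuclideanSpace ℝ (Fin n) × EuclideanSpace ℝ (Fin m)) (k : Unit) :
    fderiv ℝ (fun z => P.H rho z k) y =
      ∑ e, P.coef rho e • (EuclideanSpace.proj e).comp (ContinuousLinearMap.fst ℝ _ _) := by
  have h := ((∑ e, P.coef rho e • (EuclideanSpace.proj (𝕜 := ℝ) e).comp
    (ContinuousLinearMap.fst ℝ _ (EuclideanSpace ℝ (Fin m)))).hasFDerivAt (x := y)).sub_const P.D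
  have hH : (fun z => P.H rho z k) = fun z => (∑ e, P.coef rho e •
      (EuclideanSpace.proj (𝕜 := ℝ) e).comp
        (ContinuousLinearMap.fst ℝ _ (EuclideanSpace ℝ (Fin m)))) z - P.D := by
    funext z
    simp [H, budget_eq]
  rw [hH]
  exact h.fderiv

/-- If every `δ_e` were 0 or 1, each coordinate functional would be, up to sign, the differential of
an active bound, and the budget differential would lie in their span. -/
theorem exists_free_of_LICQ {rho : EuclideanSpace ℝ (Fin n)}
    {y : EuclideanSpace ℝ (Fin n) × EuclideanSpace ℝ (Fin m)} (hy : y.1 ∈ P.DeltaAd rho)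
    (h : ParamProgram.LICQ G P.H rho y) : ∃ e, 0 < y.1 e ∧ y.1 e < 1 := by
  by_contra! hfree
  have hne := LinearIndependent.ne_zero (Sum.inl ()) h
  rw [Sum.elim_inl] at hne
  rw [ParamProgram.LICQ, linearIndependent_sum] at h
  have hdis := h.2.2
  simp only [Sum.elim_comp_inl, Sum.elim_comp_inr] at hdis
  refine hne ((Submodule.disjoint_def.1 hdis) _ (Submodule.subset_span ⟨(), rfl⟩) ?_)
  rw [fderiv_H]
  refine Submodule.sum_mem _ fun e _ => Submodule.smul_mem _ _ ?_
  rcases (hy.1 e).1.eq_or_lt with h0 | h0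
  · rw [← neg_neg (ContinuousLinearMap.comp _ _), ← fderiv_G_inl rho y e]
    exact Submodule.neg_mem _
      (Submodule.subset_span ⟨⟨Sum.inl e, by simp [G, ← h0]⟩, rfl⟩)
  · have h1 : y.1 e = 1 := le_antisymm (hy.1 e).2 (hfree e h0)
    rw [← fderiv_G_inr rho y e]
    exact Submodule.subset_span ⟨⟨Sum.inr e, by simp [G, h1]⟩, rfl⟩

theorem fderiv_J_sub_nonpos {eps : ℝ} {rho : EuclideanSpace ℝ (Fin n)}
    (h : ∀ e, 0 < P.filtered rho e)
    {y z : EuclideanSpace ℝ (Fin n) × EuclideanSpace ℝ (Fin m)}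
    (hy : y ∈ ParamProgram.maximizers (P.J eps) G P.H rho) (hz : z.1 ∈ P.DeltaAd rho) :
    fderiv ℝ (P.J eps rho) y (z - y) ≤ 0 := by
  have hd : DifferentiableAt ℝ (P.J eps rho) y :=
    ((P.contDiffAt_J eps h (fun e => ((P.mem_feasible.1 hy.1).1 e).1) (k := 1)).comp y
      (f := fun y => (rho, y)) (by fun_prop)).differentiableAt one_ne_zero
  have hmax : IsLocalMaxOn (P.J eps rho) (ParamProgram.feasible G P.H rho) y :=
    IsMaxOn.localize fun w hw => hy.2 w hw
  exact hmax.hasFDerivWithinAt_nonpos hd.hasFDerivAt.hasFDerivWithinAt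
    (sub_mem_posTangentConeAt_of_segment_subset
      ((P.convex_feasible rho).segment_subset hy.1 (P.mem_feasible.2 hz)))

/-- Displacements are unconstrained, so the variational inequality applies to both `v` and `-v`. -/
theorem fderiv_J_displacement {eps : ℝ} {rho : EuclideanSpace ℝ (Fin n)}
    (h : ∀ e, 0 < P.filtered rho e)
    {y : EuclideanSpace ℝ (Fin n) × EuclideanSpace ℝ (Fin m)}
    (hy : y ∈ ParamProgram.maximizers (P.J eps) G P.H rho) (v : EuclideanSpace ℝ (Fin m)) :
    fderiv ℝ (P.J eps rho) y (0, v) = 0 := by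
  have hf := P.mem_feasible.1 hy.1
  have key : ∀ w, fderiv ℝ (P.J eps rho) y (0, w) ≤ 0 := fun w => by
    have h1 := P.fderiv_J_sub_nonpos h hy (z := y + (0, w)) (by simpa using hf)
    rwa [add_sub_cancel_left] at h1
  refine le_antisymm (key v) ?_
  have h2 := key (-v)
  have h3 : ((0, -v) : EuclideanSpace ℝ (Fin n) × EuclideanSpace ℝ (Fin m)) = -(0, v) := by simp
  rw [h3, map_neg] at h2
  linarith

/-- The partial derivative of the objective with respect to `δ_e`. -/
def partialJ (eps : ℝ) (rho : EuclideanSpace ℝ (Fin n))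
    (y : EuclideanSpace ℝ (Fin n) × EuclideanSpace ℝ (Fin m)) (e : Fin n) : ℝ :=
  fderiv ℝ (P.J eps rho) y (EuclideanSpace.single e 1, 0)

/-- The multiplier of the budget constraint, computed from the free coordinate `e`. -/
def budgetMultiplier (eps : ℝ) (rho : EuclideanSpace ℝ (Fin n))
    (y : EuclideanSpace ℝ (Fin n) × EuclideanSpace ℝ (Fin m)) (e : Fin n) : ℝ :=
  P.partialJ eps rho y e / P.coef rho e

/-- Exchanging uncertainty between the coordinate `i` and the free coordinate `e`. -/
theorem exchange_nonpos {eps : ℝ} {rho : EuclideanSpace ℝ (Fin n)}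
    (h : ∀ e, 0 < P.filtered rho e)
    {y : EuclideanSpace ℝ (Fin n) × EuclideanSpace ℝ (Fin m)}
    (hy : y ∈ ParamProgram.maximizers (P.J eps) G P.H rho) {e : Fin n}
    (he : 0 < y.1 e ∧ y.1 e < 1) {i : Fin n} (s : ℝ)
    (hs : ∀ᶠ t in 𝓝[>] (0 : ℝ), 0 ≤ y.1 i + t * s ∧ y.1 i + t * s ≤ 1) :
    s * (P.partialJ eps rho y i - P.budgetMultiplier eps rho y e * P.coef rho i) ≤ 0 := by
  have hf := P.mem_feasible.1 hy.1
  have hce := P.coef_pos (h e)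
  by_cases hie : i = e
  · subst hie
    rw [budgetMultiplier, div_mul_cancel₀ _ hce.ne']
    simp
  -- Lowering coordinate `e` by `c` per unit of coordinate `i` leaves the budget unchanged.
  set c := P.coef rho i / P.coef rho e with hc
  have hcont : ContinuousAt (fun t : ℝ => y.1 e - t * s * c) 0 := by fun_prop
  have h1 : ∀ᶠ t in 𝓝[>] (0 : ℝ), 0 < y.1 e - t * s * c ∧ y.1 e - t * s * c < 1 :=
    ((hcont.eventually_const_lt (by simpa using he.1)).and
      (hcont.eventually_lt_const (by simpa using he.2))).filter_mono nhdsWithin_le_nhds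
  -- One admissible positive step suffices, because the first-order inequality is linear in the
  -- direction.
  obtain ⟨t, ⟨ht1, ht2⟩, ht0 : 0 < t⟩ := ((hs.and h1).and self_mem_nhdsWithin).exists
  have hfe : (y + (t * s) • (EuclideanSpace.single i 1 - c • EuclideanSpace.single e 1, 0)).1 ∈
      P.DeltaAd rho := by
    refine ⟨fun j => ?_, ?_⟩
    · by_cases hj : j = i
      · subst hj
        simpa [hie] using ht1
      · by_cases hj' : j = e
        · subst hj'
          have := And.intro ht2.1.le ht2.2.le
          simpa [hj, sub_eq_add_neg] using this
        · simpa [hj, hj'] using hf.1 j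
    · rw [← hf.2, budget_eq, budget_eq]
      have : P.coef rho e * c = P.coef rho i := mul_div_cancel₀ _ hce.ne'
      simp only [Prod.fst_add, Prod.smul_fst, PiLp.add_apply, PiLp.smul_apply, PiLp.sub_apply,
        smul_eq_mul, mul_add, Finset.sum_add_distrib, mul_sub, Finset.sum_sub_distrib,
        PiLp.single_apply]
      simp
      linear_combination (-(t * s)) * this
  have h2 := P.fderiv_J_sub_nonpos h hy hfe
  have h3 : ((EuclideanSpace.single i 1 - c • EuclideanSpace.single e 1, 0) :
      EuclideanSpace ℝ (Fin n) × EuclideanSpace ℝ (Fin m)) =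
      (EuclideanSpace.single i 1, 0) - c • (EuclideanSpace.single e 1, 0) := by simp
  rw [add_sub_cancel_left, map_smul, h3, map_sub, map_smul, smul_eq_mul, smul_eq_mul,
    mul_assoc] at h2
  have h4 : P.budgetMultiplier eps rho y e * P.coef rho i = c * P.partialJ eps rho y e := by
    rw [budgetMultiplier, hc]; ring
  rw [h4]
  exact nonpos_of_mul_nonpos_right h2 ht0

theorem exchange_nonpos_of_lt {eps : ℝ} {rho : EuclideanSpace ℝ (Fin n)}
    (h : ∀ e, 0 < P.filtered rho e)
    {y : EuclideanSpace ℝ (Fin n) × EuclideanSpace ℝ (Fin m)}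
    (hy : y ∈ ParamProgram.maximizers (P.J eps) G P.H rho) {e : Fin n}
    (he : 0 < y.1 e ∧ y.1 e < 1) {i : Fin n} (hi : y.1 i < 1) :
    P.partialJ eps rho y i - P.budgetMultiplier eps rho y e * P.coef rho i ≤ 0 := by
  have h0 := ((P.mem_feasible.1 hy.1).1 i).1
  have hcont : ContinuousAt (fun t : ℝ => y.1 i + t * 1) 0 := by fun_prop
  have := P.exchange_nonpos h hy he (i := i) 1 (by
    filter_upwards [(hcont.eventually_lt_const (by simpa using hi)).filter_mono
      nhdsWithin_le_nhds, self_mem_nhdsWithin] with t h1 (h2 : 0 < t)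
    exact ⟨by positivity, h1.le⟩)
  simpa using this

theorem exchange_nonneg_of_pos {eps : ℝ} {rho : EuclideanSpace ℝ (Fin n)}
    (h : ∀ e, 0 < P.filtered rho e)
    {y : EuclideanSpace ℝ (Fin n) × EuclideanSpace ℝ (Fin m)}
    (hy : y ∈ ParamProgram.maximizers (P.J eps) G P.H rho) {e : Fin n}
    (he : 0 < y.1 e ∧ y.1 e < 1) {i : Fin n} (hi : 0 < y.1 i) :
    0 ≤ P.partialJ eps rho y i - P.budgetMultiplier eps rho y e * P.coef rho i := by
  have h0 := ((P.mem_feasible.1 hy.1).1 i).2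
  have hcont : ContinuousAt (fun t : ℝ => y.1 i + t * (-1)) 0 := by fun_prop
  have := P.exchange_nonpos h hy he (i := i) (-1) (by
    filter_upwards [(hcont.eventually_const_lt (by simpa using hi)).filter_mono
      nhdsWithin_le_nhds, self_mem_nhdsWithin] with t h1 (h2 : 0 < t)
    exact ⟨h1.le, by linarith⟩)
  linarith

/-- The stationarity condition in coordinates. -/
theorem stationary_iff {eps : ℝ} {rho : EuclideanSpace ℝ (Fin n)}
    (h : ∀ e, 0 < P.filtered rho e)
    {y : EuclideanSpace ℝ (Fin n) × EuclideanSpace ℝ (Fin m)}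
    (hy : y ∈ ParamProgram.maximizers (P.J eps) G P.H rho)
    (lam : Fin n ⊕ Fin n → ℝ) (mu : Unit → ℝ) :
    fderiv ℝ (P.J eps rho) y - ∑ i, lam i • fderiv ℝ (fun z => G rho z i) y
        - ∑ k, mu k • fderiv ℝ (fun z => P.H rho z k) y = 0 ↔
      ∀ e, P.partialJ eps rho y e + lam (Sum.inl e) - lam (Sum.inr e) - mu () * P.coef rho e
        = 0 := by
  set L := fderiv ℝ (P.J eps rho) y - ∑ i, lam i • fderiv ℝ (fun z => G rho z i) y
        - ∑ k, mu k • fderiv ℝ (fun z => P.H rho z k) y with hL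
  have h1 : ∀ e, L (EuclideanSpace.single e 1, 0) =
      P.partialJ eps rho y e + lam (Sum.inl e) - lam (Sum.inr e) - mu () * P.coef rho e := by
    intro e
    simp [hL, fderiv_G_inl, fderiv_G_inr, fderiv_H, partialJ]
    ring
  have h2 : ∀ v, L (0, v) = 0 := by
    intro v
    simp [hL, fderiv_G_inl, fderiv_G_inr, fderiv_H, P.fderiv_J_displacement h hy]
  constructor
  · intro h0 e
    rw [← h1, h0]
    simp
  · intro h0
    ext w
    have h3 : L (w, 0) = 0 := by
      have : L.comp (ContinuousLinearMap.inl ℝ _ _) = 0 := by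
        apply ContinuousLinearMap.coe_injective
        refine (EuclideanSpace.basisFun (Fin n) ℝ).toBasis.ext fun e => ?_
        simpa using (h1 e).trans (h0 e)
      simpa using DFunLike.congr_fun this w
    · simpa using h3
    · simpa using h2 w

/-- Complementarity kills both bound multipliers at the free coordinate, and stationarity there
fixes `mu`. Elsewhere stationarity gives the difference of the two bound multipliers, and at most
one is nonzero, so they are its positive and negative parts. That these satisfy complementarity is
the content of the exchange inequalities. -/
theorem multipliers_eq {eps : ℝ} {rho : EuclideanSpace ℝ (Fin n)}
    (h : ∀ e, 0 < P.filtered rho e)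
    {y : EuclideanSpace ℝ (Fin n) × EuclideanSpace ℝ (Fin m)}
    (hy : y ∈ ParamProgram.maximizers (P.J eps) G P.H rho) {e : Fin n}
    (he : 0 < y.1 e ∧ y.1 e < 1) :
    ParamProgram.multipliers (P.J eps) G P.H rho y =
      {(Sum.elim
          (fun i => max (P.budgetMultiplier eps rho y e * P.coef rho i - P.partialJ eps rho y i) 0)
          (fun i => max (P.partialJ eps rho y i - P.budgetMultiplier eps rho y e * P.coef rho i) 0),
        fun _ => P.budgetMultiplier eps rho y e)} := by
  have hf := P.mem_feasible.1 hy.1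
  have hce := P.coef_pos (h e)
  set mu := P.budgetMultiplier eps rho y e with hmu
  ext ⟨lam, nu⟩
  rw [ParamProgram.multipliers, Set.mem_ofPred_eq, Set.mem_singleton_iff, P.stationary_iff h hy]
  simp only [Sum.forall, G, Sum.elim_inl, Sum.elim_inr]
  constructor
  · rintro ⟨hst, ⟨hl, hr⟩, hl0, hr0⟩
    have hnu : nu () = mu := by
      have h1 : lam (Sum.inl e) = 0 := by
        rcases mul_eq_zero.1 (hl e) with h1 | h1
        · exact h1
        · linarith
      have h2 : lam (Sum.inr e) = 0 := by
        rcases mul_eq_zero.1 (hr e) with h2 | h2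
        · exact h2
        · linarith
      have h3 := hst e
      rw [h1, h2] at h3
      rw [hmu, budgetMultiplier, eq_div_iff hce.ne']
      linarith
    rw [Prod.mk.injEq]
    refine ⟨?_, funext fun _ => hnu⟩
    have key : ∀ i, lam (Sum.inl i) = max (mu * P.coef rho i - P.partialJ eps rho y i) 0 ∧
        lam (Sum.inr i) = max (P.partialJ eps rho y i - mu * P.coef rho i) 0 := by
      intro i
      have h1 := hst i
      have h2 := hl0 i
      have h3 := hr0 i
      rw [hnu] at h1
      -- The bounds `δ_i = 0` and `δ_i = 1` cannot both be active.
      have h4 : lam (Sum.inl i) = 0 ∨ lam (Sum.inr i) = 0 := by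
        rcases mul_eq_zero.1 (hl i) with h4 | h4
        · exact Or.inl h4
        · rcases mul_eq_zero.1 (hr i) with h5 | h5
          · exact Or.inr h5
          · linarith
      rcases h4 with h4 | h4
      · rw [max_eq_right (by linarith), max_eq_left (by linarith)]
        exact ⟨h4, by linarith⟩
      · rw [max_eq_left (by linarith), max_eq_right (by linarith)]
        exact ⟨by linarith, h4⟩
    funext i
    rcases i with i | i
    · exact (key i).1
    · exact (key i).2
  · intro heq
    obtain ⟨rfl, rfl⟩ := Prod.mk.inj heq
    simp only [Sum.elim_inl, Sum.elim_inr]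
    refine ⟨fun i => ?_, ⟨fun i => ?_, fun i => ?_⟩, fun i => le_max_right _ _,
      fun i => le_max_right _ _⟩
    · rcases le_total (P.partialJ eps rho y i) (mu * P.coef rho i) with h1 | h1
      · rw [max_eq_left (by linarith), max_eq_right (by linarith)]; ring
      · rw [max_eq_right (by linarith), max_eq_left (by linarith)]; ring
    · rcases (hf.1 i).1.eq_or_lt with h1 | h1
      · simp [← h1]
      · have := P.exchange_nonneg_of_pos h hy he h1
        rw [max_eq_right (by linarith), zero_mul]
    · rcases (hf.1 i).2.eq_or_lt with h1 | h1
      · simp [h1]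
      · have := P.exchange_nonpos_of_lt h hy he h1
        rw [max_eq_right (by linarith), zero_mul]

/-! ### Derivatives with respect to the density -/

theorem differentiableAt_stiffness {rho : EuclideanSpace ℝ (Fin n)}
    (h : ∀ e, 0 < P.filtered rho e) (delta : EuclideanSpace ℝ (Fin n)) (i k : Fin m) :
    DifferentiableAt ℝ (fun r => P.stiffness r delta i k) rho := by
  simp only [stiffness_apply]
  refine DifferentiableAt.fun_sum fun e _ => ?_
  exact (((P.contDiffAt_filtered_rpow (h e) (k := 1)).differentiableAt one_ne_zero).mul_const
    _).mul_const _

theorem differentiableAt_budget {rho : EuclideanSpace ℝ (Fin n)}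
    (h : ∀ e, 0 < P.filtered rho e) (delta : EuclideanSpace ℝ (Fin n)) :
    DifferentiableAt ℝ (fun r => P.budget r delta) rho := by
  simp only [budget_eq]
  refine DifferentiableAt.fun_sum fun e _ => ?_
  exact ((P.contDiffAt_coef (h e) (k := 1)).differentiableAt one_ne_zero).mul_const _

theorem hasFDerivAt_strain {rho : EuclideanSpace ℝ (Fin n)}
    (h : ∀ e, 0 < P.filtered rho e) (delta : EuclideanSpace ℝ (Fin n))
    (u : EuclideanSpace ℝ (Fin m)) :
    HasFDerivAt (fun r => P.strain r delta u)
      (∑ i, ∑ k, (u i * u k) • fderiv ℝ (fun r => P.stiffness r delta i k) rho) rho := by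
  have h1 : (fun r => P.strain r delta u) =
      fun r => ∑ i, ∑ k, (u i * u k) * P.stiffness r delta i k := by
    funext r
    simp only [strain_eq, dotProduct, Matrix.mulVec, Finset.mul_sum]
    exact Finset.sum_congr rfl fun i _ => Finset.sum_congr rfl fun k _ => by ring
  rw [h1]
  exact HasFDerivAt.fun_sum fun i _ => HasFDerivAt.fun_sum fun k _ =>
    (P.differentiableAt_stiffness h delta i k).hasFDerivAt.const_mul _

theorem hasFDerivAt_J_density (eps : ℝ) {rho : EuclideanSpace ℝ (Fin n)}
    (h : ∀ e, 0 < P.filtered rho e)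
    (y : EuclideanSpace ℝ (Fin n) × EuclideanSpace ℝ (Fin m)) :
    HasFDerivAt (fun r => P.J eps r y)
      (-∑ i, ∑ k, (y.2 i * y.2 k) • fderiv ℝ (fun r => P.stiffness r y.1 i k) rho) rho := by
  simp only [J_eq]
  exact ((P.hasFDerivAt_strain h y.1 y.2).const_sub _).sub_const _

theorem hasFDerivAt_restore {e : Fin n} {rho delta : EuclideanSpace ℝ (Fin n)}
    (h : ∀ i, 0 < P.filtered rho i) (hd : P.budget rho delta = P.D) :
    HasFDerivAt (fun r => P.restore e r delta)
      ((-(P.coef rho e)⁻¹ • fderiv ℝ (fun r => P.budget r delta) rho).smulRight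
        (EuclideanSpace.single e (1 : ℝ))) rho := by
  have h1 := (P.differentiableAt_budget h delta).hasFDerivAt.const_sub P.D
  have h2 : DifferentiableAt ℝ (fun r => (P.coef r e)⁻¹) rho :=
    ((P.contDiffAt_coef (h e) (k := 1)).differentiableAt one_ne_zero).inv (P.coef_pos (h e)).ne'
  have h3 : HasFDerivAt (fun r => (P.D - P.budget r delta) / P.coef r e)
      (-(P.coef rho e)⁻¹ • fderiv ℝ (fun r => P.budget r delta) rho) rho := by
    simp only [div_eq_mul_inv]
    have h4 := HasFDerivAt.fun_mul h1 h2.hasFDerivAt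
    -- The derivative of `1 / coef` drops out because its factor, the budget residual, is zero at
    -- `rho`.
    rwa [hd, sub_self, zero_smul, zero_add, smul_neg, ← neg_smul] at h4
  exact (h3.smul_const (EuclideanSpace.single e (1 : ℝ))).const_add delta

/-- By the chain rule through `restore`, the density enters directly and through the shift of `δ_e`.
The latter has derivative `-coef_e⁻¹ ∇budget` and is weighted by `∂J/∂δ_e`, which produces the
multiplier. -/
theorem fderiv_reducedJ_density (eps : ℝ) {e : Fin n} {rho : EuclideanSpace ℝ (Fin n)}
    (h : ∀ i, 0 < P.filtered rho i)
    {y : EuclideanSpace ℝ (Fin n) × EuclideanSpace ℝ (Fin m)} (hy : y.1 ∈ P.DeltaAd rho) :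
    (fderiv ℝ (P.reducedJ eps e) (rho, y)).comp (ContinuousLinearMap.inl ℝ _ _) =
      (-∑ i, ∑ k, (y.2 i * y.2 k) • fderiv ℝ (fun r => P.stiffness r y.1 i k) rho) -
        P.budgetMultiplier eps rho y e • fderiv ℝ (fun r => P.budget r y.1) rho := by
  have h1 : HasFDerivAt (fun r => P.reducedJ eps e (r, y))
      ((fderiv ℝ (P.reducedJ eps e) (rho, y)).comp (ContinuousLinearMap.inl ℝ _ _)) rho :=
    HasFDerivAt.comp rho (g := P.reducedJ eps e) (f := fun r => (r, y))
      ((P.contDiffAt_reducedJ eps h hy (k := 1)).differentiableAt one_ne_zero).hasFDerivAt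
      (hasFDerivAt_prodMk_left rho y)
  have hJ := ((P.contDiffAt_J eps (y := y) h (fun i => (hy.1 i).1) (k := 1)).differentiableAt
    one_ne_zero).hasFDerivAt
  set L := fderiv ℝ (fun x : EuclideanSpace ℝ (Fin n) ×
    EuclideanSpace ℝ (Fin n) × EuclideanSpace ℝ (Fin m) => P.J eps x.1 x.2) (rho, y)
  have hL1 : L.comp (ContinuousLinearMap.inl ℝ _ _) = _ :=
    (HasFDerivAt.comp rho (f := fun r => (r, y)) hJ (hasFDerivAt_prodMk_left rho y)).unique
      (P.hasFDerivAt_J_density eps h y)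
  have hL2 : L.comp (ContinuousLinearMap.inr ℝ _ _) = fderiv ℝ (P.J eps rho) y :=
    (HasFDerivAt.comp y (f := fun z => (rho, z)) hJ (hasFDerivAt_prodMk_right rho y)).fderiv.symm
  have h2 := (hasFDerivAt_id rho).prodMk
    ((P.hasFDerivAt_restore (e := e) h hy.2).prodMk (hasFDerivAt_const y.2 rho))
  have hJ' : HasFDerivAt (fun x : EuclideanSpace ℝ (Fin n) ×
      EuclideanSpace ℝ (Fin n) × EuclideanSpace ℝ (Fin m) => P.J eps x.1 x.2) L
      (rho, (P.restore e rho y.1, y.2)) := by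
    rw [P.restore_of_budget_eq hy.2]
    exact hJ
  have h3 : HasFDerivAt (fun r => P.reducedJ eps e (r, y)) _ rho :=
    HasFDerivAt.comp rho (f := fun r => (r, (P.restore e r y.1, y.2))) hJ' h2
  rw [h1.unique h3]
  ext v
  set b := fderiv ℝ (fun r => P.budget r y.1) rho
  rw [← hL1]
  have h4 : ∀ s : ℝ, L (v, (s • EuclideanSpace.single e 1, 0)) =
      L (v, 0) + s * P.partialJ eps rho y e := by
    intro s
    have h5 : ((v, (s • EuclideanSpace.single e 1, 0)) : EuclideanSpace ℝ (Fin n) ×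
        EuclideanSpace ℝ (Fin n) × EuclideanSpace ℝ (Fin m)) =
        (v, 0) + s • (0, (EuclideanSpace.single e 1, 0)) := by simp
    rw [h5, map_add, map_smul, partialJ, ← hL2]
    simp
  have h6 := h4 (-(P.coef rho e)⁻¹ * b v)
  have h7 : P.budgetMultiplier eps rho y e * b v =
      (P.coef rho e)⁻¹ * b v * P.partialJ eps rho y e := by
    rw [budgetMultiplier, div_eq_mul_inv]; ring
  simp only [ContinuousLinearMap.comp_apply, sub_apply,
    smul_apply, ContinuousLinearMap.inl_apply, smul_eq_mul, h7]
  refine Eq.trans ?_ (h6.trans (by ring))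
  rfl

theorem toDual_gradient_eq {rho : EuclideanSpace ℝ (Fin n)}
    (y : EuclideanSpace ℝ (Fin n) × EuclideanSpace ℝ (Fin m)) (mu : ℝ) :
    (-∑ i, ∑ k, (y.2 i * y.2 k) • fderiv ℝ (fun r => P.stiffness r y.1 i k) rho) -
        mu • fderiv ℝ (fun r => P.budget r y.1) rho =
      InnerProductSpace.toDual ℝ _ (WithLp.toLp 2 (fun e =>
            -(y.2.ofLp ⬝ᵥ (P.dStiffness rho y.1 e *ᵥ y.2.ofLp)))
          - mu • gradient (fun r => P.budget r y.1) rho) := by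
  rw [map_sub, map_smul, gradient, LinearIsometryEquiv.apply_symm_apply]
  congr 1
  apply ContinuousLinearMap.coe_injective
  refine (EuclideanSpace.basisFun (Fin n) ℝ).toBasis.ext fun e => ?_
  simp [dStiffness, dotProduct, Matrix.mulVec, Finset.mul_sum, EuclideanSpace.inner_single_right]
  exact Finset.sum_congr rfl fun i _ => Finset.sum_congr rfl fun k _ => by ring

end TopOptModel

end

/-! ### Assembly: differentiability of the marginal function -/

theorem theorem4 {n m q : ℕ} (P : TopOptModel n m q)
    (hK : ∀ rho ∈ P.Uad, ∀ delta : EuclideanSpace ℝ (Fin n),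
      (∀ e, 0 ≤ delta e ∧ delta e ≤ 1) → (P.stiffness rho delta).PosDef)
    (eps : ℝ) (heps : 0 < eps)
    (rhoBar : EuclideanSpace ℝ (Fin n)) (hrho : rhoBar ∈ P.Uad)
    (hne : (P.DeltaAd rhoBar).Nonempty)
    (hLICQ : ∀ y ∈ ParamProgram.maximizers (P.J eps) TopOptModel.G P.H rhoBar,
      ParamProgram.LICQ TopOptModel.G P.H rhoBar y) :
    ∃ (deltaBar : EuclideanSpace ℝ (Fin n)) (uBar : EuclideanSpace ℝ (Fin m))
      (lamBar : Fin n ⊕ Fin n → ℝ) (lambdaBar : ℝ),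
      -- `(deltaBar, uBar)` is the unique maximizer, with a unique vector of multipliers;
      -- `lambdaBar` is the multiplier of the uncertainty budget constraint
      ParamProgram.maximizers (P.J eps) TopOptModel.G P.H rhoBar = {(deltaBar, uBar)} ∧
      ParamProgram.multipliers (P.J eps) TopOptModel.G P.H rhoBar (deltaBar, uBar)
        = {(lamBar, fun _ => lambdaBar)} ∧
      -- near `rhoBar` the supremum defining the marginal function is a maximum
      (∀ᶠ rho in 𝓝 rhoBar,
        IsGreatest {t | ∃ delta ∈ P.DeltaAd rho, ∃ u, P.J eps rho (delta, u) = t}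
          (P.Feps eps rho)) ∧
      ContDiffAt ℝ 1 (P.Feps eps) rhoBar ∧
      -- the derivatives occurring in the gradient formula exist
      (∀ i k, DifferentiableAt ℝ (fun rho => P.stiffness rho deltaBar i k) rhoBar) ∧
      DifferentiableAt ℝ (fun rho => P.budget rho deltaBar) rhoBar ∧
      HasGradientAt (P.Feps eps)
        (WithLp.toLp 2 (fun e =>
            -(uBar.ofLp ⬝ᵥ (P.dStiffness rhoBar deltaBar e *ᵥ uBar.ofLp)))
          - lambdaBar • gradient (fun rho => P.budget rho deltaBar) rhoBar) rhoBar := by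
  obtain ⟨kappa, hk, hc⟩ := P.exists_eventually_mem_coerciveSet hrho (hK rhoBar hrho)
  have hc0 := hc.self_of_nhds
  have hpos := hc0.1
  obtain ⟨z, hz⟩ : ∃ z : EuclideanSpace ℝ (Fin n) →
      EuclideanSpace ℝ (Fin n) × EuclideanSpace ℝ (Fin m),
      ∀ r ∈ P.coerciveSet kappa, (P.DeltaAd r).Nonempty →
        z r ∈ ParamProgram.maximizers (P.J eps) TopOptModel.G P.H r := by
    classical
    -- A selection of maximizers; the value `0` elsewhere is irrelevant.
    refine ⟨fun r => if h : r ∈ P.coerciveSet kappa ∧ (P.DeltaAd r).Nonempty then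
      (P.maximizers_nonempty (eps := eps) hk h.1 h.2).some else 0, fun r h1 h2 => ?_⟩
    simp only [h1, h2, and_self, dite_true]
    exact Set.Nonempty.some_mem _
  have hz0 := hz rhoBar hc0 hne
  have hzf := P.mem_feasible.1 hz0.1
  obtain ⟨e, he⟩ := P.exists_free_of_LICQ hzf (hLICQ _ hz0)
  -- Feasibility persists near `rhoBar`, with the restored `(z rhoBar).1` as witness.
  have hzmax : ∀ᶠ r in 𝓝 rhoBar, z r ∈ ParamProgram.maximizers (P.J eps) TopOptModel.G P.H r := by
    filter_upwards [hc, P.eventually_restore_free hpos hzf he Filter.tendsto_id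
      tendsto_const_nhds] with r h1 h2
    exact hz r h1 ⟨_, P.restore_mem_DeltaAd (h1.1 e) hzf.1 h2⟩
  have hzcont := P.continuousAt_maximizer hk heps hc hzmax he
  have hfree : ∀ᶠ r in 𝓝 rhoBar, 0 < (z r).1 e ∧ (z r).1 e < 1 := by
    have h1 : ContinuousAt (fun r => (z r).1 e) rhoBar :=
      ((EuclideanSpace.proj (𝕜 := ℝ) e).continuous.comp continuous_fst).continuousAt.comp hzcont
    exact (h1.eventually_const_lt he.1).and (h1.eventually_lt_const he.2)
  -- On the open set `U` coercivity, maximality and freeness of `e` hold together, so the continuity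
  -- argument can be repeated at each of its points.
  obtain ⟨U, hU, hUo, hUm⟩ := eventually_nhds_iff.1 ((hc.and hzmax).and hfree)
  have hnhds : ∀ x ∈ U, ∀ᶠ r in 𝓝 x, r ∈ U := fun x hx => hUo.mem_nhds hx
  have hgreat : ∀ r ∈ U, IsGreatest {t | ∃ delta ∈ P.DeltaAd r, ∃ u, P.J eps r (delta, u) = t}
      (P.J eps r (z r)) := by
    intro r hr
    have h1 := (hU r hr).1.2
    refine ⟨⟨_, P.mem_feasible.1 h1.1, _, rfl⟩, ?_⟩
    rintro t ⟨d, hd, u, rfl⟩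
    exact h1.2 _ (P.mem_feasible.2 hd)
  have hF : ∀ r ∈ U, P.Feps eps r = P.J eps r (z r) := fun r hr => (hgreat r hr).csSup_eq
  have hzU : ContinuousOn z U := fun x hx => ContinuousAt.continuousWithinAt <|
    P.continuousAt_maximizer hk heps ((hnhds x hx).mono fun r hr => (hU r hr).1.1)
      ((hnhds x hx).mono fun r hr => (hU r hr).1.2) (hU x hx).2
  obtain ⟨hC1, hder⟩ := ContDiffAt.envelope (P.contDiffAt_reducedJ eps (e := e) hpos hzf) hUo hUm
    hzU (F := P.Feps eps)
    (fun x hx => by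
      rw [hF x hx, TopOptModel.reducedJ, P.restore_of_budget_eq (P.mem_feasible.1 (hU x hx).1.2.1).2])
    -- For `p` near `(x, x)`, restoring `z p.2` at the density `p.1` gives a feasible competitor
    -- there, so its value is at most `F_ε(p.1)`.
    (fun x hx => by
      have hxf := P.mem_feasible.1 (hU x hx).1.2.1
      have h1 : Filter.Tendsto (fun p : EuclideanSpace ℝ (Fin n) × EuclideanSpace ℝ (Fin n) =>
          (z p.2).1) (𝓝 (x, x)) (𝓝 (z x).1) :=
        (continuous_fst.tendsto _).comp
          (((hzU.continuousAt (hUo.mem_nhds hx)).tendsto).comp (continuous_snd.tendsto (x, x)))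
      have h2 := P.eventually_restore_free (hU x hx).1.1.1 hxf (hU x hx).2
        (continuous_fst.tendsto (x, x)) h1
      filter_upwards [h2, (continuous_fst.tendsto (x, x)).eventually (hnhds x hx),
        (continuous_snd.tendsto (x, x)).eventually (hnhds x hx)] with p h3 h4 h5
      rw [hF _ h4]
      exact (hU _ h4).1.2.2 _ (P.mem_feasible.2 (P.restore_mem_DeltaAd ((hU _ h4).1.1.1 e)
        (P.mem_feasible.1 (hU _ h5).1.2.1).1 h3)))
  refine ⟨(z rhoBar).1, (z rhoBar).2, _, _,
    (P.maximizers_subsingleton hk heps hc0).eq_singleton_of_mem hz0,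
    P.multipliers_eq hpos hz0 he, ?_, hC1, P.differentiableAt_stiffness hpos _,
    P.differentiableAt_budget hpos _, ?_⟩
  · filter_upwards [hnhds _ hUm] with r hr
    rw [hF r hr]
    exact hgreat r hr
  · rw [P.fderiv_reducedJ_density eps hpos hzf, TopOptModel.toDual_gradient_eq] at hder
    exact hder
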